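/- Let $\alpha>0$ be a constant and let $p=p(n)$ satisfy $p=\omega(\log^8 n/n)$, i.e. $p(n)\cdot n/\log^8 n\to\infty$ as $n\to\infty$. A directed graph $D$ on $n$ vertices is called $(n,\alpha,p)$-pseudorandom if the following three properties hold. (P1) Every vertex $v$ has in-degree and out-degree at least $(1/2+2\alpha)np$. (P2) Every set $X\subseteq V(D)$ with $|X|\le \frac{\log^2 n}{p}$ satisfies $e_D(X)\le |X|\log^{2.1}n$, where $e_D(X)$ is the number of arcs of $D$ with both endpoints in $X$. (P3) Every two disjoint sets $X,Y\subseteq V(D)$ with $|X|,|Y|\ge \frac{\log^{1.1}n}{p}$ satisfy $e_D(X,Y)\le (1+\alpha/2)|X||Y|p$, where $e_D(X,Y)$ is the number of arcs $(x,y)$ of $D$ with $x\in X$ and $y\in Y$. Then for all sufficiently large $n$, every $(n,\alpha,p)$-pseudorandom digraph $D$ (with $p=p(n)$) is Hamiltonian, that is, it contains a directed cycle passing through every vertex exactly once. -/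

import Mathlib

open Filter

namespace Digraph

/-- `d⁺(v, Y)`: the number of out-neighbours of `v` in `Y`. -/
noncomputable def outDegIn {V : Type*} (D : Digraph V) (v : V) (Y : Finset V) : ℕ :=
  open Classical in (Y.filter (fun y => D.Adj v y)).card

/-- `d⁻(v, Y)`: the number of in-neighbours of `v` in `Y`. -/
noncomputable def inDegIn {V : Type*} (D : Digraph V) (v : V) (Y : Finset V) : ℕ :=
  open Classical in (Y.filter (fun y => D.Adj y v)).card

/-- `d^±(v, Y) = min {d⁺(v, Y), d⁻(v, Y)}`. -/
noncomputable def semiDegIn {V : Type*} (D : Digraph V) (v : V) (Y : Finset V) : ℕ :=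
  min (D.outDegIn v Y) (D.inDegIn v Y)

/-- `e(X, Y)`: the number of arcs `(x, y)` with `x ∈ X` and `y ∈ Y`. -/
noncomputable def arcsBetween {V : Type*} (D : Digraph V) (X Y : Finset V) : ℕ :=
  open Classical in ((X ×ˢ Y).filter (fun q => D.Adj q.1 q.2)).card

/-- `e(X)`: the number of arcs of the subdigraph induced by `X`. -/
noncomputable def arcsIn {V : Type*} (D : Digraph V) (X : Finset V) : ℕ :=
  D.arcsBetween X X

/-- A digraph `D` on `n` vertices is `(n, α, p)`-pseudorandom; here `n = Fintype.card V`. -/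
structure IsPseudorandom {V : Type*} [Fintype V] (D : Digraph V) (α p : ℝ) : Prop where
  /-- (P1) minimum in- and out-degree. -/
  semiDeg_ge : ∀ v : V,
    (1 / 2 + 2 * α) * (Fintype.card V : ℝ) * p ≤ (D.semiDegIn v Finset.univ : ℝ)
  /-- (P2) small sets span few arcs. -/
  arcsIn_le : ∀ X : Finset V,
    (X.card : ℝ) ≤ Real.log (Fintype.card V) ^ 2 / p →
      (D.arcsIn X : ℝ) ≤ (X.card : ℝ) * Real.log (Fintype.card V) ^ (2.1 : ℝ)
  /-- (P3) no dense pair of large disjoint sets. -/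
  arcsBetween_le : ∀ X Y : Finset V, Disjoint X Y →
    Real.log (Fintype.card V) ^ (1.1 : ℝ) / p ≤ (X.card : ℝ) →
    Real.log (Fintype.card V) ^ (1.1 : ℝ) / p ≤ (Y.card : ℝ) →
      (D.arcsBetween X Y : ℝ) ≤ (1 + α / 2) * (X.card : ℝ) * (Y.card : ℝ) * p

/-- `D` contains a directed Hamilton cycle: a cyclic sequence that visits every vertex exactly once
and in which every vertex has an arc to the (cyclically) next one. -/
def IsHamiltonian {V : Type*} (D : Digraph V) : Prop :=
  ∃ c : Cycle V, c ≠ Cycle.nil ∧ c.Nodup ∧ (∀ v : V, v ∈ c) ∧ c.Chain D.Adj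

end Digraph

namespace Digraph
-- The proof is by absorption. A reservoir `R` is set aside together with a path on a vertex set `A`
-- disjoint from `R` that, for every `S ⊆ R`, can be rerouted to cover `A ∪ S` with the same two
-- ends (`exists_absorbing_path`, `exists_reservoir_absorber`). The vertices outside `A ∪ R` are
-- covered by few paths (`exists_path_cover`). These paths and the absorbing path are linked in
-- cyclic order through `R`, and the absorbing path then takes in the part of `R` that the links
-- left unused (`isHamiltonian_of_absorbing`).
--
-- All of this rests on expansion in both directions. If every vertex has degree proportionally
-- above 1/2 into a set `L`, then (P2) makes small sets expand by a factor 4 into `L`, and (P3)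
-- makes larger sets disjoint from `L` reach more than half of it (`isExpander_of_pairCount`). A
-- random equipartition keeps degrees proportional in every part (`exists_equipartition`), so its
-- parts and their unions expand.
--
-- Expansion is used twice. Hall's theorem gives perfect matchings between disjoint parts of equal
-- size (`exists_matching`), and composing these yields the path cover. Secondly, expanding through
-- logarithmically many layers forwards from one vertex and backwards from another reaches, for many
-- pairs, more than half of a middle layer from both sides, so the two searches meet. Done greedily,
-- this links prescribed pairs by disjoint walks of a fixed length (`exists_links`).
--
-- The absorber of a vertex `x` comes from one closed walk through `x` with alternating arc
-- directions. Its arcs, with further links between its vertices, can be traversed in two ways, one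
-- omitting `x` and one including it, with the same ends (`hasPath_zigzag`).
open scoped Classical in
/-- The vertices of `L` that are `E`-successors of some vertex of `X`. -/
noncomputable def nbr {V : Type*} (E : V → V → Prop) (X L : Finset V) : Finset V :=
  {y ∈ L | ∃ x ∈ X, E x y}

/-- `L` is an expanding target for `E`: small sets (of size at most `τ`) have four times as many
successors in `L`, and large sets outside `L` reach more than half of `L`, with slack `κ`. -/
structure IsExpander {V : Type*} (E : V → V → Prop) (τ κ : ℕ) (L : Finset V) : Prop where
  four_mul_le : 4 * τ ≤ L.card
  small : ∀ X : Finset V, X.card ≤ τ → 4 * X.card ≤ (nbr E X L).card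
  large : ∀ X : Finset V, Disjoint X L → τ ≤ X.card → L.card + 2 * κ < 2 * (nbr E X L).card

/-- Expansion along a relation and along its reverse. -/
def IsBiExpander {V : Type*} (E : V → V → Prop) (τ κ : ℕ) (L : Finset V) : Prop :=
  IsExpander E τ κ L ∧ IsExpander (flip E) τ κ L

/-- The vertices of the `j`-th layer that are reached from `A` through the layers `L`. -/
noncomputable def reach {V : Type*} (E : ℕ → V → V → Prop) (L : ℕ → Finset V) (A : Finset V) :
    ℕ → Finset V
  | 0 => A
  | j + 1 => nbr (E j) (reach E L A j) (L (j + 1))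

/-! ### Linking pairs of vertices through expanding layers. -/

section Connect
open scoped Classical
variable {V : Type*}

theorem mem_nbr {E : V → V → Prop} {X L : Finset V} {y : V} :
    y ∈ nbr E X L ↔ y ∈ L ∧ ∃ x ∈ X, E x y := by
  simp [nbr]

theorem nbr_subset (E : V → V → Prop) (X L : Finset V) : nbr E X L ⊆ L :=
  Finset.filter_subset _ _

theorem nbr_sdiff (E : V → V → Prop) (X L U : Finset V) : nbr E X (L \ U) = nbr E X L \ U := by
  ext y; simp only [mem_nbr, Finset.mem_sdiff]; tauto

theorem nbr_union (E : V → V → Prop) (X Y L : Finset V) :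
    nbr E (X ∪ Y) L = nbr E X L ∪ nbr E Y L := by
  ext y; simp only [mem_nbr, Finset.mem_union]; grind

theorem reach_union (E : ℕ → V → V → Prop) (L : ℕ → Finset V) (A B : Finset V) (j : ℕ) :
    reach E L (A ∪ B) j = reach E L A j ∪ reach E L B j := by
  induction j with
  | zero => rfl
  | succ j ih => simp only [reach, ih, nbr_union]

theorem reach_empty (E : ℕ → V → V → Prop) (L : ℕ → Finset V) (j : ℕ) :
    reach E L ∅ j = ∅ := by
  induction j with
  | zero => rfl
  | succ j ih => ext y; simp [reach, ih, mem_nbr]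

theorem reach_subset {E : ℕ → V → V → Prop} {L : ℕ → Finset V} {A : Finset V}
    (hA : A ⊆ L 0) (j : ℕ) : reach E L A j ⊆ L j := by
  cases j with
  | zero => exact hA
  | succ j => exact nbr_subset _ _ _

theorem exists_walk_of_mem_reach {E : ℕ → V → V → Prop} {L : ℕ → Finset V} {A : Finset V}
    {j : ℕ} {y : V} (hy : y ∈ reach E L A j) :
    ∃ w : ℕ → V, w 0 ∈ A ∧ w j = y ∧ (∀ i, 0 < i → i ≤ j → w i ∈ L i) ∧
      ∀ i < j, E i (w i) (w (i + 1)) := by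
  induction j generalizing y with
  | zero => exact ⟨fun _ => y, hy, rfl, by intro i h1 h2; omega, by simp⟩
  | succ j ih =>
    obtain ⟨hyL, x, hx, hxy⟩ := mem_nbr.1 hy
    obtain ⟨w, h0, hj, hL, hE⟩ := ih hx
    refine ⟨fun i => if i ≤ j then w i else y, by simpa using h0, by simp, ?_, ?_⟩
    · intro i hi hij
      by_cases h : i ≤ j
      · simpa [h] using hL i hi h
      · obtain rfl : i = j + 1 := by omega
        simpa using hyL
    · intro i hij
      by_cases h : i + 1 ≤ j
      · simpa [h, show i ≤ j by omega] using hE i (by omega)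
      · obtain rfl : i = j := by omega
        simpa [hj] using hxy

/-- A sequence of layers, each expanding from the previous one and disjoint from it, of which the
vertices in `U` are forbidden. -/
structure IsLayering (E : ℕ → V → V → Prop) (τ κ : ℕ) (L U : ℕ → Finset V) (h : ℕ) : Prop where
  exp : ∀ j < h, IsExpander (E j) τ κ (L (j + 1))
  disj : ∀ j < h, Disjoint (L j) (L (j + 1))
  card_le : ∀ j < h, (U (j + 1)).card ≤ κ

/-- The slack `2 * κ` in the expansion of large sets pays for the at most `κ` forbidden vertices, so
a majority of the next layer survives. -/
theorem IsLayering.lt_card_reach {E : ℕ → V → V → Prop} {τ κ : ℕ} {L U : ℕ → Finset V} {h : ℕ}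
    (H : IsLayering E τ κ L U h) {A : Finset V} (hA : A ⊆ L 0 \ U 0) {j : ℕ} (hj : j < h)
    (hτ : τ ≤ (reach E (fun j => L j \ U j) A j).card) :
    (L (j + 1)).card < 2 * (reach E (fun j => L j \ U j) A (j + 1)).card := by
  have hsub : reach E (fun j => L j \ U j) A j ⊆ L j :=
    (reach_subset (L := fun j => L j \ U j) hA j).trans Finset.sdiff_subset
  have h1 := (H.exp j hj).large _ (Disjoint.mono_left hsub (H.disj j hj)) hτ
  have h2 := Finset.le_card_sdiff (U (j + 1))
    (nbr (E j) (reach E (fun j => L j \ U j) A j) (L (j + 1)))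
  have h3 := H.card_le j hj
  simp only [reach, nbr_sdiff]
  omega

/-- Fourfold expansion less at most `2 * A.card` forbidden vertices still doubles the reached set,
since that set is never smaller than `A` while it is below `τ`. -/
theorem IsLayering.le_card_reach {E : ℕ → V → V → Prop} {τ κ : ℕ} {L U : ℕ → Finset V} {h : ℕ}
    (H : IsLayering E τ κ L U h) {A : Finset V} (hA : A ⊆ L 0 \ U 0)
    (hU : ∀ j < h, (U (j + 1)).card ≤ 2 * A.card) {j : ℕ} (hj : j ≤ h) :
    min τ (2 ^ j * A.card) ≤ (reach E (fun j => L j \ U j) A j).card := by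
  induction j with
  | zero => simp [reach]
  | succ j ih =>
    specialize ih (by omega)
    have h4 := (H.exp j (by omega)).four_mul_le
    by_cases hτ : τ ≤ (reach E (fun j => L j \ U j) A j).card
    · have := H.lt_card_reach hA (by omega) hτ
      refine (min_le_left _ _).trans ?_
      omega
    · push Not at hτ
      have h1 := (H.exp j (by omega)).small _ hτ.le
      have h2 := Finset.le_card_sdiff (U (j + 1))
        (nbr (E j) (reach E (fun j => L j \ U j) A j) (L (j + 1)))
      have h3 := hU j (by omega)
      have h5 : 2 ^ j * A.card ≤ (reach E (fun j => L j \ U j) A j).card := by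
        rcases min_le_iff.1 ih with h | h
        · omega
        · exact h
      have h6 : A.card ≤ 2 ^ j * A.card := Nat.le_mul_of_pos_left _ (by positivity)
      refine (min_le_right _ _).trans ?_
      rw [pow_succ, mul_right_comm]
      simp only [reach, nbr_sdiff]
      omega

/-- Repeated halving of the start set. From `τ` reached vertices, the next layer is reached in more
than half of its at least `4 * τ` vertices, so one of the two halves of the start set accounts for
at least `τ` of them. After `e` halvings a single vertex remains, and one more step gives it a
majority. -/
theorem IsLayering.exists_lt_card_reach_singleton {E : ℕ → V → V → Prop} {τ κ : ℕ}
    {L U : ℕ → Finset V} {h : ℕ} (H : IsLayering E τ κ L U h) (hτ : 0 < τ) (e : ℕ)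
    {A : Finset V} (hA : A ⊆ L 0 \ U 0) (hcard : A.card ≤ 2 ^ e) {j : ℕ} (hj : j + e + 1 ≤ h)
    (hr : τ ≤ (reach E (fun j => L j \ U j) A j).card) :
    ∃ a ∈ A, (L (j + e + 1)).card <
      2 * (reach E (fun j => L j \ U j) {a} (j + e + 1)).card := by
  induction e generalizing A j with
  | zero =>
    have hne : A.Nonempty := by
      rw [Finset.nonempty_iff_ne_empty]
      rintro rfl
      rw [reach_empty] at hr
      simp at hr; omega
    have h1 : A.card = 1 := by have := hne.card_pos; simp at hcard; omega
    obtain ⟨a, rfl⟩ := Finset.card_eq_one.1 h1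
    exact ⟨a, by simp, H.lt_card_reach hA (by omega) hr⟩
  | succ e ih =>
    obtain ⟨B, hB, hBc⟩ := Finset.exists_subset_card_eq (s := A) (n := A.card / 2) (by omega)
    have hlt := H.lt_card_reach hA (j := j) (by omega) hr
    have h4 := (H.exp j (by omega)).four_mul_le
    have hAB : A = B ∪ (A \ B) := (Finset.union_sdiff_of_subset hB).symm
    have hu : (reach E (fun j => L j \ U j) A (j + 1)).card ≤
        (reach E (fun j => L j \ U j) B (j + 1)).card +
          (reach E (fun j => L j \ U j) (A \ B) (j + 1)).card := by
      conv_lhs => rw [hAB, reach_union]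
      exact Finset.card_union_le _ _
    have hc2 := Finset.card_sdiff_of_subset hB
    rw [pow_succ] at hcard
    have key : ∃ C ⊆ A, C.card ≤ 2 ^ e ∧
        τ ≤ (reach E (fun j => L j \ U j) C (j + 1)).card := by
      by_cases hc : τ ≤ (reach E (fun j => L j \ U j) B (j + 1)).card
      · exact ⟨B, hB, by omega, hc⟩
      · exact ⟨A \ B, Finset.sdiff_subset, by omega, by omega⟩
    obtain ⟨C, hCA, hCc, hCr⟩ := key
    obtain ⟨a, ha, hlt'⟩ := ih (hCA.trans hA) hCc (j := j + 1) (by omega) hCr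
    refine ⟨a, hCA ha, ?_⟩
    rwa [show j + (e + 1) + 1 = j + 1 + e + 1 by ring]

/-- Fewer than half of the starting vertices fail to reach more than half of the last layer. -/
theorem IsLayering.two_mul_card_lt [Fintype V] {E : ℕ → V → V → Prop} {τ κ Λ : ℕ}
    {L U : ℕ → Finset V} {h : ℕ} (H : IsLayering E τ κ L U h) (hτ : 0 < τ)
    (hV : Fintype.card V ≤ 2 ^ Λ) (hh : 2 * Λ + 1 ≤ h) {s : ℕ} (hs : 0 < s)
    (hU : ∀ j < h, (U (j + 1)).card ≤ s)
    {B : Finset V} (hB : B ⊆ L 0 \ U 0)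
    (hbad : ∀ b ∈ B, 2 * (reach E (fun j => L j \ U j) {b} h).card ≤ (L h).card) :
    2 * B.card < s := by
  -- The negation `s ≤ 2 * B.card` is the bound on forbidden vertices that doubling needs. The first
  -- `h - Λ - 1 ≥ Λ` layers raise the reach of `B` to `τ`; the last `Λ + 1` isolate one vertex of
  -- `B`, which cannot be bad.
  by_contra! hc
  have h1 := H.le_card_reach hB (fun j hj => (hU j hj).trans hc) (j := h - Λ - 1) (by omega)
  have h2 : τ ≤ 2 ^ (h - Λ - 1) * B.card := by
    have h3 : 2 ^ Λ ≤ 2 ^ (h - Λ - 1) := Nat.pow_le_pow_right (by norm_num) (by omega)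
    have h4 := (H.exp 0 (by omega)).four_mul_le
    have h5 := Finset.card_le_univ (L (0 + 1))
    have h6 : 0 < B.card := by omega
    nlinarith
  rw [min_eq_left h2] at h1
  obtain ⟨a, ha, hlt⟩ := H.exists_lt_card_reach_singleton hτ Λ hB
    ((Finset.card_le_univ _).trans hV) (j := h - Λ - 1) (by omega) h1
  rw [show h - Λ - 1 + Λ + 1 = h by omega] at hlt
  have := hbad a ha
  omega

/-- `w` is a walk of `N` steps from `a` to `b`, following the relations `E`, whose inner vertices
run through the layers `L`. -/
structure IsLink (E : ℕ → V → V → Prop) (N : ℕ) (L : ℕ → Finset V) (a b : V) (w : ℕ → V) :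
    Prop where
  zero : w 0 = a
  last : w N = b
  mem : ∀ j, 0 < j → j < N → w j ∈ L j
  rel : ∀ j < N, E j (w j) (w (j + 1))

theorem IsLink.mono {E : ℕ → V → V → Prop} {N : ℕ} {L L' : ℕ → Finset V} {a b : V} {w : ℕ → V}
    (h : IsLink E N L a b w) (hL : ∀ j, 0 < j → j < N → L j ⊆ L' j) : IsLink E N L' a b w :=
  ⟨h.zero, h.last, fun j h1 h2 => hL j h1 h2 (h.mem j h1 h2), h.rel⟩

variable {G : V → V → Prop} {τ κ Λ N : ℕ} {E : ℕ → V → V → Prop}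

/-- Bi-expansion does not distinguish the two directions; hence the linking lemmas also produce
walks with alternating arc directions. -/
theorem IsBiExpander.of_eq_or {L : Finset V} (h : IsBiExpander G τ κ L) {F : V → V → Prop}
    (hF : F = G ∨ F = flip G) : IsBiExpander F τ κ L := by
  rcases hF with rfl | rfl
  · exact h
  · exact ⟨h.2, h.1⟩

/-- For fewer than half of the indices the forward search from `a i` fails to reach a majority of
layer `2 * Λ + 1`, and likewise for the backward search from `b i`. Some index succeeds in both, and
two majorities of one layer intersect. -/
theorem exists_isLink_avoiding [Fintype V] {ι : Type*}
    (hτ : 0 < τ) (hV : Fintype.card V ≤ 2 ^ Λ) (hN : 4 * Λ + 2 ≤ N)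
    (hE : ∀ j, E j = G ∨ E j = flip G) {L : ℕ → Finset V} {S : Finset V}
    (hL : ∀ j, 0 < j → j < N → IsBiExpander G τ κ (L j))
    (hdisj : ∀ j, 0 < j → j + 1 < N → Disjoint (L j) (L (j + 1)))
    (hS : ∀ j, 0 < j → j < N → Disjoint S (L j))
    {I : Finset ι} (hI : I.Nonempty) {a b : ι → V} (haS : ∀ i ∈ I, a i ∈ S)
    (hbS : ∀ i ∈ I, b i ∈ S) (ha : Set.InjOn a I) (hb : Set.InjOn b I) (hIκ : I.card ≤ κ)
    {U : ℕ → Finset V} (hU : ∀ j, 0 < j → j < N → (U j).card ≤ I.card) :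
    ∃ i ∈ I, ∃ w, IsLink E N (fun j => L j \ U j) (a i) (b i) w := by
  set h := 2 * Λ + 1 with hh
  -- Layer 0 of either search is the terminal set `S`, with nothing forbidden there.
  let Lf : ℕ → Finset V := fun j => if j = 0 then S else L j
  let Uf : ℕ → Finset V := fun j => if j = 0 then ∅ else U j
  let Lb : ℕ → Finset V := fun j => if j = 0 then S else L (N - j)
  let Ub : ℕ → Finset V := fun j => if j = 0 then ∅ else U (N - j)
  let Eb : ℕ → V → V → Prop := fun j => flip (E (N - 1 - j))
  have Hf : IsLayering E τ κ Lf Uf h := by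
    refine ⟨fun j hj => ?_, fun j hj => ?_, fun j hj => ?_⟩
    · exact ((hL (j + 1) (by omega) (by omega)).of_eq_or (hE j)).1
    · rcases Nat.eq_zero_or_pos j with rfl | hj0
      · simpa [Lf] using hS 1 (by omega) (by omega)
      · simpa [Lf, hj0.ne'] using hdisj j hj0 (by omega)
    · exact (hU _ (by omega) (by omega)).trans hIκ
  have Hb : IsLayering Eb τ κ Lb Ub (N - h) := by
    refine ⟨fun j hj => ?_, fun j hj => ?_, fun j hj => ?_⟩
    · exact ((hL (N - (j + 1)) (by omega) (by omega)).of_eq_or (hE _)).2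
    · rcases Nat.eq_zero_or_pos j with rfl | hj0
      · simpa [Lb] using hS (N - 1) (by omega) (by omega)
      · have := hdisj (N - (j + 1)) (by omega) (by omega)
        rw [show N - (j + 1) + 1 = N - j by omega] at this
        simpa [Lb, hj0.ne'] using this.symm
    · exact (hU (N - (j + 1)) (by omega) (by omega)).trans hIκ
  have key : ∃ i ∈ I, (Lf h).card < 2 * (reach E (fun j => Lf j \ Uf j) {a i} h).card ∧
      (Lb (N - h)).card < 2 * (reach Eb (fun j => Lb j \ Ub j) {b i} (N - h)).card := by
    by_contra! hcon
    let Ia := {i ∈ I | 2 * (reach E (fun j => Lf j \ Uf j) {a i} h).card ≤ (Lf h).card}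
    let Ib := {i ∈ I | 2 * (reach Eb (fun j => Lb j \ Ub j) {b i} (N - h)).card ≤
      (Lb (N - h)).card}
    have h1 : 2 * (Ia.image a).card < I.card := by
      refine Hf.two_mul_card_lt hτ hV (by omega) hI.card_pos
        (fun j hj => hU _ (by omega) (by omega)) ?_ ?_
      · intro v hv
        obtain ⟨i, hi, rfl⟩ := Finset.mem_image.1 hv
        simpa [Lf, Uf] using haS i (Finset.mem_filter.1 hi).1
      · intro v hv
        obtain ⟨i, hi, rfl⟩ := Finset.mem_image.1 hv
        exact (Finset.mem_filter.1 hi).2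
    have h2 : 2 * (Ib.image b).card < I.card := by
      refine Hb.two_mul_card_lt hτ hV (by omega) hI.card_pos
        (fun j hj => hU (N - (j + 1)) (by omega) (by omega)) ?_ ?_
      · intro v hv
        obtain ⟨i, hi, rfl⟩ := Finset.mem_image.1 hv
        simpa [Lb, Ub] using hbS i (Finset.mem_filter.1 hi).1
      · intro v hv
        obtain ⟨i, hi, rfl⟩ := Finset.mem_image.1 hv
        exact (Finset.mem_filter.1 hi).2
    rw [Finset.card_image_of_injOn (ha.mono (by intro i hi; exact (Finset.mem_filter.1 hi).1))] at h1
    rw [Finset.card_image_of_injOn (hb.mono (by intro i hi; exact (Finset.mem_filter.1 hi).1))] at h2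
    have h3 : I ⊆ Ia ∪ Ib := by
      intro i hi
      rw [Finset.mem_union, Finset.mem_filter, Finset.mem_filter]
      by_cases hc : (Lf h).card < 2 * (reach E (fun j => Lf j \ Uf j) {a i} h).card
      · exact Or.inr ⟨hi, hcon i hi hc⟩
      · exact Or.inl ⟨hi, not_lt.1 hc⟩
    have h4 := (Finset.card_le_card h3).trans (Finset.card_union_le _ _)
    omega
  obtain ⟨i, hi, hf, hbk⟩ := key
  refine ⟨i, hi, ?_⟩
  have hLf : Lf h = L h := by simp [Lf, hh]
  have hLb : Lb (N - h) = L h := by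
    simp only [Lb]; rw [if_neg (by omega), show N - (N - h) = h by omega]
  have hfs : reach E (fun j => Lf j \ Uf j) {a i} h ⊆ L h := by
    rw [← hLf]; obtain ⟨m, hm⟩ : ∃ m, h = m + 1 := ⟨2 * Λ, hh⟩
    rw [hm]; exact (nbr_subset _ _ _).trans Finset.sdiff_subset
  have hbs : reach Eb (fun j => Lb j \ Ub j) {b i} (N - h) ⊆ L h := by
    rw [← hLb]; obtain ⟨m, hm⟩ : ∃ m, N - h = m + 1 := ⟨N - h - 1, by omega⟩
    rw [hm]; exact (nbr_subset _ _ _).trans Finset.sdiff_subset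
  obtain ⟨y, hy⟩ : (reach E (fun j => Lf j \ Uf j) {a i} h ∩
      reach Eb (fun j => Lb j \ Ub j) {b i} (N - h)).Nonempty := by
    rw [← Finset.card_pos]
    have h1 := Finset.card_union_add_card_inter (reach E (fun j => Lf j \ Uf j) {a i} h)
      (reach Eb (fun j => Lb j \ Ub j) {b i} (N - h))
    have h2 := Finset.card_le_card (Finset.union_subset hfs hbs)
    rw [hLf] at hf; rw [hLb] at hbk
    omega
  rw [Finset.mem_inter] at hy
  obtain ⟨w, hw0, hwh, hwL, hwE⟩ := exists_walk_of_mem_reach hy.1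
  obtain ⟨w', hw'0, hw'h, hw'L, hw'E⟩ := exists_walk_of_mem_reach hy.2
  refine ⟨fun j => if j ≤ h then w j else w' (N - j), ?_, ?_, ?_, ?_⟩
  · simpa using hw0
  · simp only [show ¬ N ≤ h by omega, if_false, Nat.sub_self]
    simpa using hw'0
  · intro j h1 h2
    by_cases hj : j ≤ h
    · have := hwL j h1 hj
      simpa [hj, Lf, Uf, h1.ne'] using this
    · have := hw'L (N - j) (by omega) (by omega)
      simp only [Lb, Ub, if_neg (show N - j ≠ 0 by omega), show N - (N - j) = j by omega] at this
      simpa only [hj, if_false] using this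
  · intro j h1
    by_cases hj : j + 1 ≤ h
    · simpa only [hj, show j ≤ h by omega, if_true] using hwE j (by omega)
    · have := hw'E (N - (j + 1)) (by omega)
      simp only [Eb, flip, show N - 1 - (N - (j + 1)) = j by omega,
        show N - (j + 1) + 1 = N - j by omega] at this
      by_cases hj' : j ≤ h
      · obtain rfl : j = h := by omega
        rw [hw'h] at this
        simpa only [le_refl, if_true, hj, if_false, hwh] using this
      · simpa only [hj, hj', if_false] using this

/-- In one family of layers, at least half of the pairs can be linked disjointly. -/
theorem exists_half_links [Fintype V] {ι : Type*}
    (hτ : 0 < τ) (hV : Fintype.card V ≤ 2 ^ Λ) (hN : 4 * Λ + 2 ≤ N)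
    (hE : ∀ j, E j = G ∨ E j = flip G) {L : ℕ → Finset V} {S : Finset V}
    (hL : ∀ j, 0 < j → j < N → IsBiExpander G τ κ (L j))
    (hdisj : ∀ j, 0 < j → j + 1 < N → Disjoint (L j) (L (j + 1)))
    (hS : ∀ j, 0 < j → j < N → Disjoint S (L j))
    {I : Finset ι} {a b : ι → V} (haS : ∀ i ∈ I, a i ∈ S)
    (hbS : ∀ i ∈ I, b i ∈ S) (ha : Set.InjOn a I) (hb : Set.InjOn b I) (hIκ : I.card ≤ κ)
    (c : ℕ) (hc : 2 * c ≤ I.card + 1) :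
    ∃ J ⊆ I, J.card = c ∧ ∃ w : ι → ℕ → V, (∀ i ∈ J, IsLink E N L (a i) (b i) (w i)) ∧
      ∀ j, 0 < j → j < N → Set.InjOn (fun i => w i j) J := by
  induction c with
  | zero => 
    refine ⟨∅, by simp, by simp, fun i _ => a i, by simp, by simp⟩
  | succ c ih =>
    obtain ⟨J, hJI, hJc, w, hw, hinj⟩ := ih (by omega)
    have hc2 := Finset.card_sdiff_of_subset hJI
    have hsub : (I \ J : Finset ι) ⊆ I := Finset.sdiff_subset
    -- In each layer the chosen walks occupy at most `c` vertices. This is at most the number of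
    -- unlinked pairs precisely as long as no more than half have been linked.
    obtain ⟨i₀, hi₀, w₀, hw₀⟩ := exists_isLink_avoiding (I := I \ J) (a := a) (b := b)
      (U := fun j => J.image (fun i => w i j)) hτ hV hN hE hL hdisj hS
      (Finset.card_pos.1 (by omega)) (fun i hi => haS i (hsub hi)) (fun i hi => hbS i (hsub hi))
      (ha.mono (by exact_mod_cast hsub)) (hb.mono (by exact_mod_cast hsub)) (by omega)
      (fun j _ _ => Finset.card_image_le.trans (by omega))
    rw [Finset.mem_sdiff] at hi₀
    refine ⟨insert i₀ J, ?_, ?_, Function.update w i₀ w₀, ?_, ?_⟩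
    · exact Finset.insert_subset hi₀.1 hJI
    · rw [Finset.card_insert_of_notMem hi₀.2, hJc]
    · intro i hi
      rcases Finset.mem_insert.1 hi with rfl | hiJ
      · simpa using hw₀.mono (fun j _ _ => Finset.sdiff_subset)
      · have : i ≠ i₀ := fun h => hi₀.2 (h ▸ hiJ)
        simpa [this] using hw i hiJ
    · intro j h1 h2
      rw [Finset.coe_insert, Set.injOn_insert (by exact_mod_cast hi₀.2)]
      have heq : ∀ i ∈ J, Function.update w i₀ w₀ i j = w i j := by
        intro i hi
        have : i ≠ i₀ := by rintro rfl; exact hi₀.2 hi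
        simp [this]
      constructor
      · intro x hx y hy hxy
        simp only [heq x hx, heq y hy] at hxy
        exact hinj j h1 h2 hx hy hxy
      · rintro ⟨i, hi, hii⟩
        simp only [heq i hi, Function.update_self] at hii
        have := hw₀.mem j h1 h2
        rw [Finset.mem_sdiff, Finset.mem_image] at this
        exact this.2 ⟨i, hi, hii⟩

/-- Given enough families of layers, all pairs can be linked disjointly. -/
theorem exists_links [Fintype V] {ι : Type*}
    (hτ : 0 < τ) (hV : Fintype.card V ≤ 2 ^ Λ) (hN : 4 * Λ + 2 ≤ N)
    (hE : ∀ j, E j = G ∨ E j = flip G) {L : ℕ → ℕ → Finset V} {S : Finset V} (r : ℕ)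
    (hL : ∀ ρ < r, ∀ j, 0 < j → j < N → IsBiExpander G τ κ (L ρ j))
    (hdisj : ∀ ρ < r, ∀ j, 0 < j → j + 1 < N → Disjoint (L ρ j) (L ρ (j + 1)))
    (hdisj' : ∀ ρ < r, ∀ ρ' < r, ρ ≠ ρ' → ∀ j, 0 < j → j < N → Disjoint (L ρ j) (L ρ' j))
    (hS : ∀ ρ < r, ∀ j, 0 < j → j < N → Disjoint S (L ρ j))
    {I : Finset ι} {a b : ι → V} (haS : ∀ i ∈ I, a i ∈ S)
    (hbS : ∀ i ∈ I, b i ∈ S) (ha : Set.InjOn a I) (hb : Set.InjOn b I) (hIκ : I.card ≤ κ)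
    (hr : I.card < 2 ^ r) :
    ∃ w : ι → ℕ → V,
      (∀ i ∈ I, IsLink E N (fun j => (Finset.range r).biUnion fun ρ => L ρ j) (a i) (b i) (w i)) ∧
      ∀ j, 0 < j → j < N → Set.InjOn (fun i => w i j) I := by
  induction r generalizing I with
  | zero =>
    obtain rfl : I = ∅ := by simpa using hr
    exact ⟨fun i _ => a i, by simp, by simp⟩
  | succ r ih =>
    -- Family `r` serves half of the pairs, rounded up. Fewer than `2 ^ r` pairs remain for the
    -- other families, whose layers are disjoint from those just used.
    obtain ⟨J, hJI, hJc, w, hw, hinj⟩ := exists_half_links hτ hV hN hE (hL r (by omega))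
      (hdisj r (by omega)) (hS r (by omega)) haS hbS ha hb hIκ ((I.card + 1) / 2) (by omega)
    have hc2 := Finset.card_sdiff_of_subset hJI
    have hsub : (I \ J : Finset ι) ⊆ I := Finset.sdiff_subset
    rw [pow_succ] at hr
    obtain ⟨w', hw', hinj'⟩ := ih (I := I \ J) (fun ρ hρ => hL ρ (by omega))
      (fun ρ hρ => hdisj ρ (by omega)) (fun ρ hρ ρ' hρ' => hdisj' ρ (by omega) ρ' (by omega))
      (fun ρ hρ => hS ρ (by omega))
      (fun i hi => haS i (hsub hi)) (fun i hi => hbS i (hsub hi))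
      (ha.mono (by exact_mod_cast hsub)) (hb.mono (by exact_mod_cast hsub)) (by omega) (by omega)
    refine ⟨fun i => if i ∈ J then w i else w' i, fun i hi => ?_, fun j h1 h2 => ?_⟩
    · by_cases hJ : i ∈ J
      · simp only [hJ, if_true]
        refine (hw i hJ).mono fun j _ _ => ?_
        exact Finset.subset_biUnion_of_mem (fun ρ => L ρ j) (by simp)
      · simp only [hJ, if_false]
        refine (hw' i (by simp [hi, hJ])).mono fun j _ _ => ?_
        exact Finset.biUnion_subset_biUnion_of_subset_left _ (by simp)
    · have hne : ∀ x ∈ J, ∀ y ∈ I \ J, w x j ≠ w' y j := by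
        intro x hx y hy heq
        have h3 := (hw x hx).mem j h1 h2
        have h4 := (hw' y hy).mem j h1 h2
        rw [Finset.mem_biUnion] at h4
        obtain ⟨ρ, hρ, h4⟩ := h4
        rw [Finset.mem_range] at hρ
        rw [heq] at h3
        exact Finset.disjoint_left.1 (hdisj' r (by omega) ρ (by omega) (by omega) j h1 h2) h3 h4
      intro x hx y hy hxy
      simp only at hxy
      by_cases hxJ : x ∈ J <;> by_cases hyJ : y ∈ J <;>
        simp only [hxJ, hyJ, if_true, if_false] at hxy
      · exact hinj j h1 h2 hxJ hyJ hxy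
      · exact absurd hxy (hne x hxJ y (Finset.mem_sdiff.2 ⟨hy, hyJ⟩))
      · exact absurd hxy.symm (hne y hyJ x (Finset.mem_sdiff.2 ⟨hx, hxJ⟩))
      · exact hinj' j h1 h2 (by simpa [hxJ] using hx) (by simpa [hyJ] using hy) hxy

end Connect
-- A Chernoff bound and random equipartitions.
theorem exp_neg_le_quadratic {x : ℝ} (hx : 0 ≤ x) : Real.exp (-x) ≤ 1 - x + x ^ 2 / 2 := by
  have h1 := Real.quadratic_le_exp_of_nonneg hx
  have h2 : Real.exp (-x) * Real.exp x = 1 := by rw [← Real.exp_add]; simp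
  have h3 := Real.exp_pos (-x)
  nlinarith [sq_nonneg (x ^ 2), sq_nonneg x, mul_nonneg h3.le (sq_nonneg (x - 1)),
    mul_le_mul_of_nonneg_left h1 (show 0 ≤ 1 - x + x ^ 2 / 2 by nlinarith [sq_nonneg (x - 1)])]

open scoped Classical in
/-- A lower-tail Chernoff bound, in counting form: among the functions `σ : G → A` few hit the sets
`S g` much less often than expected. -/
theorem card_filter_hits_lt_le {G A : Type*} [Fintype G] [Fintype A] [Nonempty A]
    (S : G → Finset A) {ε D : ℝ} (hε : 0 ≤ ε) (hD0 : 0 ≤ D) (hD : D ≤ ∑ g, ((S g).card : ℝ)) :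
    (({σ : G → A | (({g | σ g ∈ S g} : Finset G).card : ℝ) < (1 - ε) * (D / Fintype.card A)} :
      Finset (G → A)).card : ℝ) ≤
      (Fintype.card (G → A) : ℝ) * Real.exp (-(ε ^ 2 / 2) * (D / Fintype.card A)) := by
  set q : ℝ := ((Fintype.card A : ℕ) : ℝ) with hq
  have hq0 : 0 < q := by rw [hq]; exact_mod_cast Fintype.card_pos
  set B : Finset (G → A) :=
    {σ : G → A | (({g | σ g ∈ S g} : Finset G).card : ℝ) < (1 - ε) * (D / q)} with hB
  -- The exponential moment, with parameter `-ε`, of the number of hits; its sum over all `σ`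
  -- factorises over the coordinates.
  let f : (G → A) → ℝ := fun σ => ∏ g, if σ g ∈ S g then Real.exp (-ε) else 1
  have hf : ∀ σ, f σ = Real.exp (-ε * (({g | σ g ∈ S g} : Finset G).card : ℝ)) := by
    intro σ
    simp only [f]
    rw [Finset.prod_ite, Finset.prod_const, Finset.prod_const_one, mul_one, ← Real.exp_nat_mul]
    ring_nf
  have hsum : ∑ σ, f σ = ∏ g, ∑ a, (if a ∈ S g then Real.exp (-ε) else 1) := by
    rw [Finset.prod_univ_sum, Fintype.piFinset_univ]
  have hfac : ∀ g, ∑ a, (if a ∈ S g then Real.exp (-ε) else 1) ≤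
      q * Real.exp (-((1 - Real.exp (-ε)) * ((S g).card / q))) := by
    intro g
    have h1 : ∑ a, (if a ∈ S g then Real.exp (-ε) else (1 : ℝ)) =
        q - (1 - Real.exp (-ε)) * (S g).card := by
      have : ∀ a, (if a ∈ S g then Real.exp (-ε) else (1 : ℝ)) =
          1 - (if a ∈ S g then 1 - Real.exp (-ε) else 0) := by
        intro a; split_ifs <;> ring
      simp only [this, Finset.sum_sub_distrib, Finset.sum_ite_mem, Finset.univ_inter,
        Finset.sum_const, Finset.card_univ, nsmul_eq_mul, mul_one, hq]
      ring
    rw [h1]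
    have h2 := Real.add_one_le_exp (-((1 - Real.exp (-ε)) * ((S g).card / q)))
    have h3 := mul_le_mul_of_nonneg_left h2 hq0.le
    refine le_trans (le_of_eq ?_) h3
    field_simp
    ring
  have hexp : Real.exp (-ε) ≤ 1 := by rw [Real.exp_le_one_iff]; linarith
  have htot : ∑ σ, f σ ≤ (Fintype.card (G → A) : ℝ) *
      Real.exp (-((1 - Real.exp (-ε)) * (D / q))) := by
    rw [hsum]
    calc _ ≤ ∏ g, q * Real.exp (-((1 - Real.exp (-ε)) * ((S g).card / q))) := by
          refine Finset.prod_le_prod (fun g _ => Finset.sum_nonneg fun a _ => ?_)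
            fun g _ => hfac g
          split_ifs <;> positivity
      _ = (Fintype.card (G → A) : ℝ) *
          Real.exp (-((1 - Real.exp (-ε)) * ((∑ g, ((S g).card : ℝ)) / q))) := by
          rw [Finset.prod_mul_distrib, ← Real.exp_sum, Finset.sum_neg_distrib, ← Finset.mul_sum,
            ← Finset.sum_div]
          simp [hq]
      _ ≤ _ := by
          have : 0 ≤ 1 - Real.exp (-ε) := by linarith
          gcongr
  have hlow : (B.card : ℝ) * Real.exp (-(ε * ((1 - ε) * (D / q)))) ≤ ∑ σ, f σ := by
    calc (B.card : ℝ) * Real.exp (-(ε * ((1 - ε) * (D / q))))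
        = ∑ σ ∈ B, Real.exp (-(ε * ((1 - ε) * (D / q)))) := by simp
      _ ≤ ∑ σ ∈ B, f σ := by
          refine Finset.sum_le_sum fun σ hσ => ?_
          rw [hf, Real.exp_le_exp]
          have := (Finset.mem_filter.1 hσ).2
          nlinarith
      _ ≤ _ := by
          refine Finset.sum_le_sum_of_subset_of_nonneg (Finset.subset_univ _) fun σ _ _ => ?_
          rw [hf]; positivity
  have hμ : 0 ≤ D / q := by positivity
  have h1 : (B.card : ℝ) = (B.card : ℝ) * Real.exp (-(ε * ((1 - ε) * (D / q)))) *
      Real.exp (ε * ((1 - ε) * (D / q))) := by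
    rw [mul_assoc, ← Real.exp_add]; simp
  rw [h1]
  calc _ ≤ (Fintype.card (G → A) : ℝ) * Real.exp (-((1 - Real.exp (-ε)) * (D / q))) *
        Real.exp (ε * ((1 - ε) * (D / q))) := by
        exact mul_le_mul_of_nonneg_right (hlow.trans htot) (Real.exp_pos _).le
    _ ≤ _ := by
        rw [mul_assoc, ← Real.exp_add]
        gcongr
        have := exp_neg_le_quadratic hε
        nlinarith

open scoped Classical in
/-- A set `W` has a partition, up to fewer than `q` leftover elements, into `q` parts of the same
size, each of which meets each of the given sets `N t` in about the expected number of elements. -/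
theorem exists_equipartition {V T : Type*} [Fintype T] (W : Finset V) (N : T → Finset V)
    (hN : ∀ t, N t ⊆ W) {q : ℕ} (hq : 0 < q) {ε D : ℝ} (hε : 0 ≤ ε) (hD0 : 0 ≤ D)
    (hD : ∀ t, D + q ≤ ((N t).card : ℝ))
    (hprob : (Fintype.card T : ℝ) * q * Real.exp (-(ε ^ 2 / 2) * (D / q)) < 1) :
    ∃ L : Fin q → Finset V, (∀ j, L j ⊆ W) ∧ (∀ i j, i ≠ j → Disjoint (L i) (L j)) ∧
      (∀ j, (L j).card = W.card / q) ∧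
      ∀ t j, (1 - ε) * (D / q) ≤ ((N t ∩ L j).card : ℝ) := by
  have : NeZero q := ⟨hq.ne'⟩
  set m := W.card / q with hm
  have hmq : m * q ≤ W.card := Nat.div_mul_le_self _ _
  have hmq' : W.card ≤ m * q + q := by
    have := Nat.div_add_mod W.card q
    have := Nat.mod_lt W.card hq
    rw [mul_comm] at *
    simp only [hm]; nlinarith
  obtain ⟨W', hW', hW'c⟩ := Finset.exists_subset_card_eq hmq
  -- Up to fewer than `q` leftovers, `W` is arranged as an `m × q` grid. A random `σ` rotates each
  -- row independently, and part `j` takes from row `g` the entry `j + σ g`. Parts are then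
  -- automatically disjoint and of size `m`, while each single part makes independent uniform
  -- choices in the rows, as the Chernoff bound requires.
  have e : W' ≃ Fin m × Fin q := Fintype.equivOfCardEq (by simp [hW'c])
  let v : Fin m → Fin q → V := fun g i => (e.symm (g, i) : V)
  have hv : ∀ g i g' i', v g i = v g' i' → g = g' ∧ i = i' := by
    intro g i g' i' h
    have := e.symm.injective (Subtype.ext h)
    simpa using this
  have hvW : ∀ g i, v g i ∈ W := fun g i => hW' (e.symm (g, i)).2
  have hcount : ∀ t (j : Fin q), D ≤ ∑ g, ((({i | v g (j + i) ∈ N t} : Finset (Fin q)).card) : ℝ) := by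
    intro t j
    have h1 : ∀ g, ({i | v g (j + i) ∈ N t} : Finset (Fin q)).card =
        ({i | v g i ∈ N t} : Finset (Fin q)).card := by
      intro g
      refine Finset.card_bij (fun i _ => j + i) (by simp) (by simp) ?_
      intro b hb
      exact ⟨b - j, by simpa using hb, by simp⟩
    have h2 : ∑ g, ({i | v g i ∈ N t} : Finset (Fin q)).card = (N t ∩ W').card := by
      rw [← Finset.card_sigma]
      refine Finset.card_bij (fun x _ => v x.1 x.2) ?_ ?_ ?_
      · rintro ⟨g, i⟩ hx
        simp only [Finset.mem_sigma, Finset.mem_univ, true_and, Finset.mem_filter] at hx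
        exact Finset.mem_inter.2 ⟨hx, (e.symm (g, i)).2⟩
      · rintro ⟨g, i⟩ _ ⟨g', i'⟩ _ h
        obtain ⟨rfl, rfl⟩ := hv _ _ _ _ h
        rfl
      · intro b hb
        rw [Finset.mem_inter] at hb
        refine ⟨⟨(e ⟨b, hb.2⟩).1, (e ⟨b, hb.2⟩).2⟩, ?_, ?_⟩ <;> simp [v, hb.1]
    have h3 : (N t).card ≤ (N t ∩ W').card + q := by
      have h4 := Finset.card_sdiff_add_card_inter (N t) W'
      have h5 := Finset.card_le_card (Finset.sdiff_subset_sdiff (hN t) (Finset.Subset.refl W'))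
      have h6 := Finset.card_sdiff_of_subset hW'
      omega
    have h4 := hD t
    have h5 : ((N t).card : ℝ) ≤ (N t ∩ W').card + q := by exact_mod_cast h3
    simp only [h1]
    rw [← Nat.cast_sum, h2]
    linarith
  let Bad : T × Fin q → Finset (Fin m → Fin q) := fun tj =>
    {σ | (({g | σ g ∈ ({i | v g (tj.2 + i) ∈ N tj.1} : Finset (Fin q))} : Finset (Fin m)).card : ℝ) <
      (1 - ε) * (D / q)}
  have hBad : ∀ tj, ((Bad tj).card : ℝ) ≤ (Fintype.card (Fin m → Fin q) : ℝ) *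
      Real.exp (-(ε ^ 2 / 2) * (D / q)) := by
    intro tj
    have := card_filter_hits_lt_le (fun g => ({i | v g (tj.2 + i) ∈ N tj.1} : Finset (Fin q)))
      hε hD0 (hcount tj.1 tj.2)
    rw [Fintype.card_fin] at this
    convert this
  -- Union bound over all pairs of a given set and a part.
  obtain ⟨σ, hσ⟩ : ∃ σ, ∀ tj, σ ∉ Bad tj := by
    by_contra! hcon
    have h1 : (Finset.univ : Finset (Fin m → Fin q)) ⊆ Finset.univ.biUnion Bad := by
      intro σ _
      obtain ⟨tj, h⟩ := hcon σ
      exact Finset.mem_biUnion.2 ⟨tj, by simp, h⟩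
    have h2 : (Fintype.card (Fin m → Fin q) : ℝ) ≤ ∑ tj, ((Bad tj).card : ℝ) := by
      exact_mod_cast (Finset.card_le_card h1).trans Finset.card_biUnion_le
    have h3 := h2.trans (Finset.sum_le_sum fun tj _ => hBad tj)
    rw [Finset.sum_const, Finset.card_univ, Fintype.card_prod, Fintype.card_fin, nsmul_eq_mul] at h3
    have h4 : (0 : ℝ) < Fintype.card (Fin m → Fin q) := by exact_mod_cast Fintype.card_pos
    push_cast at h3
    nlinarith
  refine ⟨fun j => Finset.univ.image fun g => v g (j + σ g), ?_, ?_, ?_, ?_⟩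
  · intro j x hx
    obtain ⟨g, _, rfl⟩ := Finset.mem_image.1 hx
    exact hvW _ _
  · intro i j hij
    rw [Finset.disjoint_left]
    intro x hx hx'
    obtain ⟨g, _, rfl⟩ := Finset.mem_image.1 hx
    obtain ⟨g', _, h⟩ := Finset.mem_image.1 hx'
    obtain ⟨rfl, h⟩ := hv _ _ _ _ h
    exact hij (by simpa using h.symm)
  · intro j
    rw [Finset.card_image_of_injective, Finset.card_univ, Fintype.card_fin]
    intro g g' h
    exact (hv _ _ _ _ h).1
  · intro t j
    have h1 := hσ (t, j)
    simp only [Bad, Finset.mem_filter, Finset.mem_univ, true_and, not_lt] at h1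
    refine h1.trans ?_
    norm_cast
    refine Finset.card_le_card_of_injOn (fun g => v g (j + σ g)) ?_ ?_
    · intro g hg
      simp only [Finset.coe_filter, Finset.mem_univ, true_and, Set.mem_ofPred_eq] at hg
      simp [hg]
    · intro g _ g' _ h
      exact (hv _ _ _ _ h).1

/-! ### Path concatenation and the two traversals of an absorber. -/

/-- There is an `E`-path from `a` to `b` whose vertices, with multiplicity, are those of `M`. -/
def HasPath {V : Type*} (E : V → V → Prop) (a b : V) (M : Multiset V) : Prop :=
  ∃ l : List V, l.IsChain E ∧ l.head? = some a ∧ l.getLast? = some b ∧ (l : Multiset V) = M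

section Paths
open scoped Classical
variable {V : Type*} {E : V → V → Prop}

theorem HasPath.singleton (E : V → V → Prop) (a : V) : HasPath E a a {a} :=
  ⟨[a], by simp, rfl, rfl, rfl⟩

theorem HasPath.append {a b c d : V} {M M' : Multiset V} (h : HasPath E a b M) (hbc : E b c)
    (h' : HasPath E c d M') : HasPath E a d (M + M') := by
  obtain ⟨l, hl, ha, hb, rfl⟩ := h
  obtain ⟨l', hl', hc, hd, rfl⟩ := h'
  refine ⟨l ++ l', ?_, ?_, ?_, by simp⟩
  · rw [List.isChain_append]
    refine ⟨hl, hl', ?_⟩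
    simp [hb, hc, hbc]
  · simp [List.head?_append, ha]
  · simp [List.getLast?_append, hd]

theorem HasPath.mem_left {a b : V} {M : Multiset V} (h : HasPath E a b M) : a ∈ M := by
  obtain ⟨l, hl, ha, hb, rfl⟩ := h
  exact List.mem_of_mem_head? (by simp [ha])

theorem HasPath.mem_right {a b : V} {M : Multiset V} (h : HasPath E a b M) : b ∈ M := by
  obtain ⟨l, hl, ha, hb, rfl⟩ := h
  exact List.mem_of_mem_getLast? (by simp [hb])

theorem HasPath.sum {s t : ℕ → V} {M : ℕ → Multiset V} (n : ℕ)
    (h : ∀ i ≤ n, HasPath E (s i) (t i) (M i)) (hE : ∀ i < n, E (t i) (s (i + 1))) :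
    HasPath E (s 0) (t n) (∑ i ∈ Finset.range (n + 1), M i) := by
  induction n with
  | zero => simpa using h 0 le_rfl
  | succ n ih =>
    rw [Finset.sum_range_succ]
    exact (ih (fun i hi => h i (by omega)) (fun i hi => hE i (by omega))).append (hE n (by omega))
      (h (n + 1) le_rfl)

theorem HasPath.isHamiltonian [Fintype V] {D : Digraph V} {a b : V}
    (h : HasPath D.Adj a b (Finset.univ : Finset V).val) (hba : D.Adj b a) : D.IsHamiltonian := by
  obtain ⟨l, hl, ha, hb, hM⟩ := h
  have hnd : l.Nodup := by
    rw [← Multiset.coe_nodup, hM]; exact Finset.univ.nodup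
  have hmem : ∀ v, v ∈ l := by
    intro v
    rw [← Multiset.mem_coe, hM]; exact Finset.mem_univ v
  cases l with
  | nil => simp at ha
  | cons x l =>
    obtain rfl : x = a := by simpa using ha
    refine ⟨((x :: l : List V) : Cycle V), ?_, ?_, ?_, ?_⟩
    · simp
    · simpa using hnd
    · intro v; simpa using hmem v
    · rw [Cycle.chain_coe_cons]
      rw [← List.cons_append, List.isChain_append]
      refine ⟨hl, by simp, ?_⟩
      simp [hb, hba]

/-- The inner vertices of a walk of `N` steps. -/
noncomputable def innerVertices (N : ℕ) (w : ℕ → V) : Multiset V :=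
  ∑ j ∈ Finset.range (N - 1), {w (j + 1)}

theorem IsLink.hasPath_inner {N : ℕ} {L : ℕ → Finset V} {a b : V} {w : ℕ → V} (hN : 2 ≤ N)
    (h : IsLink (fun _ => E) N L a b w) : HasPath E (w 1) (w (N - 1)) (innerVertices N w) := by
  obtain ⟨m, rfl⟩ : ∃ m, N = m + 2 := ⟨N - 2, by omega⟩
  exact HasPath.sum (s := fun i => w (i + 1)) (t := fun i => w (i + 1)) m
    (fun i _ => HasPath.singleton E _) (fun i hi => h.rel (i + 1) (by omega))

theorem HasPath.link {N : ℕ} {L : ℕ → Finset V} {a b c d : V} {w : ℕ → V} {M M' : Multiset V}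
    (h : HasPath E a b M) (hN : 2 ≤ N) (hw : IsLink (fun _ => E) N L b c w)
    (h' : HasPath E c d M') : HasPath E a d (M + innerVertices N w + M') := by
  refine (h.append ?_ (hw.hasPath_inner hN)).append ?_ h'
  · have := hw.rel 0 (by omega)
    rwa [hw.zero] at this
  · have := hw.rel (N - 1) (by omega)
    rwa [show N - 1 + 1 = N by omega, hw.last] at this

theorem sum_singleton_eq_val_image {ι : Type*} {s : Finset ι} {f : ι → V}
    (hf : Set.InjOn f s) : ∑ i ∈ s, ({f i} : Multiset V) = (s.image f).val := by
  rw [← Finset.sum_multiset_singleton, Finset.sum_image hf]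

theorem sum_innerVertices_eq {ι : Type*} {I : Finset ι} {E : ℕ → V → V → Prop} {N : ℕ}
    {L : ℕ → Finset V} {a b : ι → V} {w : ι → ℕ → V}
    (hw : ∀ i ∈ I, IsLink E N L (a i) (b i) (w i))
    (hinj : ∀ j, 0 < j → j < N → Set.InjOn (fun i => w i j) I)
    (hL : ∀ j, 0 < j → j < N → ∀ j', 0 < j' → j' < N → j ≠ j' → Disjoint (L j) (L j')) :
    ∃ T : Finset V, (∀ v ∈ T, ∃ j, 0 < j ∧ j < N ∧ v ∈ L j) ∧
      ∑ i ∈ I, innerVertices N (w i) = T.val := by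
  refine ⟨(I ×ˢ Finset.range (N - 1)).image fun x => w x.1 (x.2 + 1), ?_, ?_⟩
  · intro v hv
    obtain ⟨⟨i, j⟩, hij, rfl⟩ := Finset.mem_image.1 hv
    rw [Finset.mem_product, Finset.mem_range] at hij
    exact ⟨j + 1, by omega, by omega, (hw i hij.1).mem _ (by omega) (by omega)⟩
  · rw [← sum_singleton_eq_val_image, Finset.sum_product]
    · rfl
    · rintro ⟨i, j⟩ hij ⟨i', j'⟩ hij' h
      simp only [Finset.coe_product, Set.mem_prod, Finset.mem_coe, Finset.mem_range] at hij hij' h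
      by_cases hjj : j = j'
      · subst hjj
        rw [hinj (j + 1) (by omega) (by omega) hij.1 hij'.1 h]
      · exfalso
        have h1 := (hw i hij.1).mem (j + 1) (by omega) (by omega)
        have h2 := (hw i' hij'.1).mem (j' + 1) (by omega) (by omega)
        rw [h] at h1
        exact Finset.disjoint_left.1 (hL (j + 1) (by omega) (by omega) (j' + 1) (by omega)
          (by omega) (by omega)) h1 h2

theorem sum_range_two_mul {M : Type*} [AddCommMonoid M] (f : ℕ → M) (n : ℕ) :
    ∑ c ∈ Finset.range (2 * n), f c =
      ∑ e ∈ Finset.range n, f (2 * e) + ∑ e ∈ Finset.range n, f (2 * e + 1) := by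
  induction n with
  | zero => simp
  | succ n ih =>
    rw [show 2 * (n + 1) = 2 * n + 1 + 1 by ring, Finset.sum_range_succ, Finset.sum_range_succ, ih,
      Finset.sum_range_succ, Finset.sum_range_succ]
    abel

/-- The absorber without its vertex. -/
theorem hasPath_absorber {u v : ℕ → V} {M : ℕ → Multiset V} {n : ℕ} (hn : 0 < n)
    (hM : ∀ c < 2 * n, HasPath E (u c) (v (c + 1)) (M c))
    (hvu : ∀ c ≤ 2 * n, E (v c) (u c)) :
    HasPath E (v 0) (u (2 * n)) ({v 0} + ∑ c ∈ Finset.range (2 * n), M c + {u (2 * n)}) := by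
  obtain ⟨m, hm⟩ : ∃ m, 2 * n = m + 1 := ⟨2 * n - 1, by omega⟩
  -- Without the vertex, the segments are visited in their natural order, using the arcs from `v c`
  -- to `u c`.
  have h1 := HasPath.sum (s := u) (t := fun c => v (c + 1)) m (fun i hi => hM i (by omega))
    (fun i hi => hvu (i + 1) (by omega))
  rw [← hm] at h1
  refine ((HasPath.singleton E (v 0)).append (hvu 0 (by omega)) h1).append ?_
    (HasPath.singleton E _)
  have := hvu (2 * n) le_rfl
  rwa [hm] at *

/-- The absorber, with its vertex `x` absorbed. -/
theorem hasPath_absorber_insert {u v : ℕ → V} {x : V} {M : ℕ → Multiset V} {n : ℕ} (hn : 0 < n)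
    (hM : ∀ c < 2 * n, HasPath E (u c) (v (c + 1)) (M c))
    (hvu : ∀ c < 2 * n, E (v c) (u (c + 1))) (hvx : E (v (2 * n)) x) (hxu : E x (u 0)) :
    HasPath E (v 0) (u (2 * n))
      ({v 0} + ∑ c ∈ Finset.range (2 * n), M c + {u (2 * n)} + {x}) := by
  obtain ⟨m, rfl⟩ : ∃ m, n = m + 1 := ⟨n - 1, by omega⟩
  -- With the arcs from `v c` to `u (c + 1)` every second segment is skipped: first the odd
  -- segments, ending in `v (2 * n)`, then `x`, then the even segments from `u 0`. The evenness of
  -- the number of segments makes both traversals end in `u (2 * n)`.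
  have h1 := HasPath.sum (s := fun e => u (2 * e + 1)) (t := fun e => v (2 * e + 1 + 1))
    (M := fun e => M (2 * e + 1)) m (fun i hi => hM _ (by omega))
    (fun i hi => hvu (2 * i + 1 + 1) (by omega))
  have h2 := HasPath.sum (s := fun e => u (2 * e)) (t := fun e => v (2 * e + 1))
    (M := fun e => M (2 * e)) m (fun i hi => hM _ (by omega))
    (fun i hi => hvu (2 * i + 1) (by omega))
  have h3 := ((((HasPath.singleton E (v 0)).append (hvu 0 (by omega)) h1).append
    hvx (HasPath.singleton E x)).append hxu h2).append (hvu (2 * m + 1) (by omega))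
      (HasPath.singleton E _)
  rw [sum_range_two_mul]
  rw [show 2 * m + 1 + 1 = 2 * (m + 1) by ring] at h3
  convert h3 using 1
  abel

end Paths
-- Expansion from arc counts, and perfect matchings.
open scoped Classical in
/-- The number of pairs in `X × Y` that are related by `E`. -/
noncomputable def pairCount {V : Type*} (E : V → V → Prop) (X Y : Finset V) : ℕ :=
  {q ∈ X ×ˢ Y | E q.1 q.2}.card

section Expansion
open scoped Classical
variable {V : Type*} {E : V → V → Prop}

theorem pairCount_flip (E : V → V → Prop) (X Y : Finset V) :
    pairCount (flip E) X Y = pairCount E Y X := by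
  refine Finset.card_bij (fun q _ => q.swap) ?_ ?_ ?_
  · rintro ⟨x, y⟩ h
    rw [Finset.mem_filter, Finset.mem_product] at h ⊢
    exact ⟨⟨h.1.2, h.1.1⟩, h.2⟩
  · rintro ⟨x, y⟩ _ ⟨x', y'⟩ _ h
    simp only [Prod.swap, Prod.mk.injEq] at h ⊢
    tauto
  · rintro ⟨x, y⟩ h
    refine ⟨(y, x), ?_, rfl⟩
    rw [Finset.mem_filter, Finset.mem_product] at h ⊢
    exact ⟨⟨h.1.2, h.1.1⟩, h.2⟩

theorem pairCount_eq_sum (E : V → V → Prop) (X Y : Finset V) :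
    pairCount E X Y = ∑ x ∈ X, {y ∈ Y | E x y}.card := by
  rw [pairCount, Finset.card_filter, Finset.sum_product]
  exact Finset.sum_congr rfl fun x _ => (Finset.card_filter _ _).symm

theorem pairCount_le_of_nbr_subset {X Y L : Finset V} (h : nbr E X L ⊆ Y) :
    pairCount E X L ≤ pairCount E X Y := by
  refine Finset.card_le_card fun q hq => ?_
  rw [Finset.mem_filter, Finset.mem_product] at hq ⊢
  exact ⟨⟨hq.1.1, h (mem_nbr.2 ⟨hq.1.2, q.1, hq.1.1, hq.2⟩)⟩, hq.2⟩

theorem pairCount_mono {X Y X' Y' : Finset V} (h : X ⊆ X') (h' : Y ⊆ Y') :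
    pairCount E X Y ≤ pairCount E X' Y' :=
  Finset.card_le_card (Finset.filter_subset_filter _ (Finset.product_subset_product h h'))

/-- Minimum degree into `L`, sparseness of small sets and an upper density bound for large pairs
make `L` expanding. -/
theorem isExpander_of_pairCount {L : Finset V} {τ κ : ℕ} {d β s p : ℝ} (hp : 0 < p) (hβ : 0 < β)
    (hτ : 0 < τ) (hL : 4 * τ ≤ L.card) (hdeg : ∀ v, d ≤ ({y ∈ L | E v y}.card : ℝ))
    (hsmall : ∀ X : Finset V, X.card ≤ 5 * τ → (pairCount E X X : ℝ) ≤ X.card * s)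
    (hlarge : ∀ X Y : Finset V, Disjoint X Y → τ ≤ X.card → τ ≤ Y.card →
      (pairCount E X Y : ℝ) ≤ β * X.card * Y.card * p)
    (hs : 0 ≤ s) (hds : 5 * s < d) (hdβ : β * (L.card + 2 * κ) * p < 2 * d) :
    IsExpander E τ κ L := by
  have hcount : ∀ X : Finset V, (X.card : ℝ) * d ≤ pairCount E X L := by
    intro X
    rw [pairCount_eq_sum]
    push_cast
    rw [← nsmul_eq_mul]
    exact Finset.card_nsmul_le_sum _ _ _ fun x _ => hdeg x
  refine ⟨hL, fun X hX => ?_, fun X hXL hX => ?_⟩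
  -- Otherwise `X` and its neighbours form a set of at most `5 * X.card` vertices containing all
  -- arcs from `X` into `L`, too many for the sparseness bound because `5 * s < d`.
  · by_contra! hlt
    have h1 : (X ∪ nbr E X L).card ≤ 5 * X.card := by
      have := Finset.card_union_le X (nbr E X L)
      omega
    have h2 := hsmall (X ∪ nbr E X L) (by omega)
    have h3 : (pairCount E X L : ℝ) ≤ pairCount E (X ∪ nbr E X L) (X ∪ nbr E X L) := by
      exact_mod_cast (pairCount_le_of_nbr_subset (Finset.Subset.refl _)).trans
        (pairCount_mono Finset.subset_union_left Finset.subset_union_right)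
    have h4 : ((X ∪ nbr E X L).card : ℝ) ≤ 5 * X.card := by exact_mod_cast h1
    have h5 : (0 : ℝ) < X.card := by
      have : 0 < X.card := by omega
      exact_mod_cast this
    have h6 := hcount X
    nlinarith
  -- The neighbourhood is padded to size at least `τ` so that the density bound applies. The
  -- conclusion `Y.card > L.card / 2 + κ ≥ 2 * τ` shows afterwards that no padding occurred.
  · obtain ⟨Y, hNY, hYL, hYc⟩ := Finset.exists_subsuperset_card_eq (nbr_subset E X L)
      (le_max_left (nbr E X L).card τ)
      (max_le (Finset.card_le_card (nbr_subset E X L)) (by omega))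
    have h1 := hlarge X Y (hXL.mono_right hYL) hX (hYc ▸ le_max_right _ _)
    have h2 : (pairCount E X L : ℝ) ≤ pairCount E X Y := by
      exact_mod_cast pairCount_le_of_nbr_subset hNY
    have h3 := hcount X
    have h4 : (0 : ℝ) < X.card := by exact_mod_cast lt_of_lt_of_le hτ hX
    have h5 : d ≤ β * Y.card * p := by
      have : (X.card : ℝ) * d ≤ X.card * (β * Y.card * p) := by linarith
      exact le_of_mul_le_mul_left this h4
    have h6 : (L.card + 2 * κ : ℝ) < 2 * Y.card := by
      have : (β * p) * (L.card + 2 * κ : ℝ) < (β * p) * (2 * Y.card) := by linarith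
      exact lt_of_mul_lt_mul_left this (by positivity)
    have h7 : L.card + 2 * κ < 2 * Y.card := by exact_mod_cast h6
    rcases max_cases (nbr E X L).card τ with h | h <;> omega

/-- Two expanding sets of the same size are joined by a perfect matching. -/
theorem exists_matching {τ κ : ℕ} {A B : Finset V} (hAB : Disjoint A B) (hc : A.card = B.card)
    (hB : IsExpander E τ κ B) (hA : IsExpander (flip E) τ κ A) :
    ∃ g : V → V, Set.InjOn g A ∧ ∀ a ∈ A, g a ∈ B ∧ E a (g a) := by
  -- Hall's condition. Small sets expand, and sets up to half of `A` reach more than half of `B`.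
  -- For larger `S`, the unreached vertices of `B` have all their in-neighbours from `A` in `A \ S`,
  -- which is less than half of `A`; reverse expansion then forces them to be few.
  have hall : ∀ S ⊆ A, S.card ≤ (nbr E S B).card := by
    intro S hS
    by_cases h1 : S.card ≤ τ
    · have := hB.small S h1; omega
    · have h2 := hB.large S (hAB.mono_left hS) (by omega)
      by_cases h3 : 2 * S.card ≤ B.card
      · omega
      · have h4 : nbr (flip E) (B \ nbr E S B) A ⊆ A \ S := by
          intro a ha
          obtain ⟨haA, b, hb, hab⟩ := mem_nbr.1 ha
          rw [Finset.mem_sdiff] at hb ⊢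
          exact ⟨haA, fun haS => hb.2 (mem_nbr.2 ⟨hb.1, a, haS, hab⟩)⟩
        have h5 := Finset.card_le_card h4
        rw [Finset.card_sdiff_of_subset hS] at h5
        have h6 := Finset.card_sdiff_of_subset (nbr_subset E S B)
        have h7 := Finset.card_le_card hS
        by_cases h8 : (B \ nbr E S B).card ≤ τ
        · have := hA.small _ h8; omega
        · have := hA.large (B \ nbr E S B)
            ((hAB.mono_right Finset.sdiff_subset).symm) (by omega)
          omega
  have h := (Finset.all_card_le_biUnion_card_iff_exists_injective
    (fun a : A => nbr E {(a : V)} B)).1 ?_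
  · obtain ⟨f, hf, hfm⟩ := h
    refine ⟨fun v => if hv : v ∈ A then f ⟨v, hv⟩ else v, ?_, ?_⟩
    · intro x hx y hy hxy
      simp only [Finset.mem_coe] at hx hy
      simp only [hx, hy, dif_pos] at hxy
      simpa using hf hxy
    · intro a ha
      simp only [ha, dif_pos]
      have := mem_nbr.1 (hfm ⟨a, ha⟩)
      simpa using this
  · intro s
    have h1 := hall (s.map (Function.Embedding.subtype _)) (by
      intro x hx
      obtain ⟨y, _, rfl⟩ := Finset.mem_map.1 hx
      exact y.2)
    rw [Finset.card_map] at h1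
    refine h1.trans (Finset.card_le_card ?_)
    intro y hy
    obtain ⟨hyB, x, hx, hxy⟩ := mem_nbr.1 hy
    obtain ⟨x', hx', rfl⟩ := Finset.mem_map.1 hx
    exact Finset.mem_biUnion.2 ⟨x', hx', mem_nbr.2 ⟨hyB, x', by simp, hxy⟩⟩

/-- Matchings between consecutive parts compose to injections from the first part. -/
theorem exists_transversals {τ κ q : ℕ} {Z : ℕ → Finset V}
    (hdisj : ∀ j, j + 1 < q → Disjoint (Z j) (Z (j + 1)))
    (hc : ∀ j < q, (Z j).card = (Z 0).card) (hZ : ∀ j < q, IsBiExpander E τ κ (Z j)) :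
    ∃ φ : ℕ → V → V, (∀ v, φ 0 v = v) ∧
      (∀ j < q, Set.InjOn (φ j) (Z 0) ∧ ∀ z ∈ Z 0, φ j z ∈ Z j) ∧
      ∀ j, j + 1 < q → ∀ z ∈ Z 0, E (φ j z) (φ (j + 1) z) := by
  have hm : ∀ j, ∃ g : V → V, j + 1 < q → Set.InjOn g (Z j) ∧ ∀ a ∈ Z j, g a ∈ Z (j + 1) ∧ E a (g a) := by
    intro j
    by_cases hj : j + 1 < q
    · obtain ⟨g, hg⟩ := exists_matching (hdisj j hj)
        ((hc j (by omega)).trans (hc (j + 1) hj).symm) (hZ (j + 1) hj).1 (hZ j (by omega)).2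
      exact ⟨g, fun _ => hg⟩
    · exact ⟨id, fun h => absurd h hj⟩
  choose g hg using hm
  let φ : ℕ → V → V := fun j => Nat.rec id (fun j f => g j ∘ f) j
  have hφ : ∀ j < q, Set.InjOn (φ j) (Z 0) ∧ ∀ z ∈ Z 0, φ j z ∈ Z j := by
    intro j
    induction j with
    | zero => intro _; exact ⟨Set.injOn_id _, fun z hz => hz⟩
    | succ j ih =>
      intro hj
      obtain ⟨h1, h2⟩ := ih (by omega)
      exact ⟨(hg j hj).1.comp h1 (fun z hz => h2 z hz), fun z hz => ((hg j hj).2 _ (h2 z hz)).1⟩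
  exact ⟨φ, fun _ => rfl, hφ, fun j hj z hz => ((hg j hj).2 _ ((hφ j (by omega)).2 z hz)).2⟩

end Expansion
-- Layer families, path covers and absorbing gadgets.
/-- Families (indexed by `ρ < r`) of layers (indexed by `0 < j < N`), which are bi-expanders,
pairwise disjoint, and disjoint from `S`. -/
structure IsLayerFamily {V : Type*} (G : V → V → Prop) (τ κ r N : ℕ) (L : ℕ → ℕ → Finset V)
    (S : Finset V) : Prop where
  biexp : ∀ ρ < r, ∀ j, 0 < j → j < N → IsBiExpander G τ κ (L ρ j)
  disj : ∀ ρ < r, ∀ j, 0 < j → j < N → ∀ ρ' < r, ∀ j', 0 < j' → j' < N → (ρ, j) ≠ (ρ', j') →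
    Disjoint (L ρ j) (L ρ' j')
  disj_left : ∀ ρ < r, ∀ j, 0 < j → j < N → Disjoint S (L ρ j)

open scoped Classical in
/-- The union of all layers. -/
noncomputable def layerUnion {V : Type*} (r N : ℕ) (L : ℕ → ℕ → Finset V) : Finset V :=
  (Finset.range r).biUnion fun ρ => (Finset.Ioo 0 N).biUnion fun j => L ρ j

section Assembly
open scoped Classical
variable {V : Type*} {G : V → V → Prop} {τ κ Λ N r : ℕ}

theorem mem_layerUnion {L : ℕ → ℕ → Finset V} {v : V} :
    v ∈ layerUnion r N L ↔ ∃ ρ < r, ∃ j, 0 < j ∧ j < N ∧ v ∈ L ρ j := by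
  simp only [layerUnion, Finset.mem_biUnion, Finset.mem_range, Finset.mem_Ioo, and_assoc]

theorem IsLayerFamily.exists_links [Fintype V] {ι : Type*} {L : ℕ → ℕ → Finset V} {S : Finset V}
    (hL : IsLayerFamily G τ κ r N L S) {E : ℕ → V → V → Prop}
    (hτ : 0 < τ) (hV : Fintype.card V ≤ 2 ^ Λ) (hN : 4 * Λ + 2 ≤ N)
    (hE : ∀ j, E j = G ∨ E j = flip G) {I : Finset ι} {a b : ι → V} (haS : ∀ i ∈ I, a i ∈ S)
    (hbS : ∀ i ∈ I, b i ∈ S) (ha : Set.InjOn a I) (hb : Set.InjOn b I) (hIκ : I.card ≤ κ)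
    (hr : I.card < 2 ^ r) :
    ∃ (w : ι → ℕ → V) (P : ℕ → Finset V) (T : Finset V),
      (∀ i ∈ I, IsLink E N P (a i) (b i) (w i)) ∧
      (∀ i ∈ I, ∀ j, 0 < j → j < N → w i j ∈ layerUnion r N L) ∧
      (∀ i ∈ I, ∀ j, 0 < j → j < N → ∀ i' ∈ I, ∀ j', 0 < j' → j' < N → w i j = w i' j' →
        i = i' ∧ j = j') ∧
      T ⊆ layerUnion r N L ∧ ∑ i ∈ I, innerVertices N (w i) = T.val := by
  obtain ⟨w, hw, hinj⟩ := Digraph.exists_links hτ hV hN hE r hL.biexp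
    (fun ρ hρ j h1 h2 => hL.disj ρ hρ j h1 (by omega) ρ hρ (j + 1) (by omega) h2 (by simp))
    (fun ρ hρ ρ' hρ' hne j h1 h2 => hL.disj ρ hρ j h1 h2 ρ' hρ' j h1 h2 (by simp [hne]))
    hL.disj_left haS hbS ha hb hIκ hr
  have hP : ∀ j, 0 < j → j < N → ∀ j', 0 < j' → j' < N → j ≠ j' →
      Disjoint ((Finset.range r).biUnion fun ρ => L ρ j)
        ((Finset.range r).biUnion fun ρ => L ρ j') := by
    intro j h1 h2 j' h1' h2' hne
    rw [Finset.disjoint_biUnion_left]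
    intro ρ hρ
    rw [Finset.disjoint_biUnion_right]
    intro ρ' hρ'
    exact hL.disj ρ (Finset.mem_range.1 hρ) j h1 h2 ρ' (Finset.mem_range.1 hρ') j' h1' h2'
      (by simp [hne])
  have hsub : ∀ j, 0 < j → j < N → ∀ v ∈ (Finset.range r).biUnion fun ρ => L ρ j,
      v ∈ layerUnion r N L := by
    intro j h1 h2 v hv
    obtain ⟨ρ, hρ, hv⟩ := Finset.mem_biUnion.1 hv
    exact mem_layerUnion.2 ⟨ρ, Finset.mem_range.1 hρ, j, h1, h2, hv⟩
  obtain ⟨T, hT, hTs⟩ := sum_innerVertices_eq hw hinj hP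
  refine ⟨w, _, T, hw, fun i hi j h1 h2 => hsub j h1 h2 _ ((hw i hi).mem j h1 h2), ?_, ?_, hTs⟩
  · intro i hi j h1 h2 i' hi' j' h1' h2' h
    have hjj : j = j' := by
      by_contra hne
      have h3 := (hw i hi).mem j h1 h2
      rw [h] at h3
      exact Finset.disjoint_left.1 (hP j h1 h2 j' h1' h2' hne) h3 ((hw i' hi').mem j' h1' h2')
    subst hjj
    exact ⟨hinj j h1 h2 hi hi' h, rfl⟩
  · intro v hv
    obtain ⟨j, h1, h2, hv⟩ := hT v hv
    exact hsub j h1 h2 v hv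

/-- A set partitioned into bi-expanders of the same size, and leftover vertices, is covered by
few paths. -/
theorem exists_path_cover {q : ℕ} (hq : 0 < q) {Z : ℕ → Finset V} {W : Finset V}
    (hZW : ∀ j < q, Z j ⊆ W) (hdisj : ∀ i < q, ∀ j < q, i ≠ j → Disjoint (Z i) (Z j))
    (hc : ∀ j < q, (Z j).card = (Z 0).card) (hZ : ∀ j < q, IsBiExpander G τ κ (Z j)) :
    ∃ (T : Finset V) (e : V → V) (M : V → Multiset V),
      (∀ v ∈ T, HasPath G v (e v) (M v)) ∧ ∑ v ∈ T, M v = W.val ∧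
      T.card + q * (Z 0).card ≤ (Z 0).card + W.card := by
  obtain ⟨φ, hφ0, hφ, hφE⟩ := exists_transversals
    (fun j hj => hdisj j (by omega) (j + 1) hj (by omega)) hc hZ
  set U := (Finset.range q).biUnion Z with hU
  have hUW : U ⊆ W := Finset.biUnion_subset.2 fun j hj => hZW j (Finset.mem_range.1 hj)
  have hpd : Set.PairwiseDisjoint (↑(Finset.range q)) Z := by
    intro i hi j hj hij
    exact hdisj i (by simpa using hi) j (by simpa using hj) hij
  have hZ0U : Z 0 ⊆ U := Finset.subset_biUnion_of_mem Z (by simpa using hq)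
  have hZ0 : Disjoint (Z 0) (W \ U) := Disjoint.mono_left hZ0U Finset.disjoint_sdiff
  have himg : ∀ j < q, (Z 0).image (φ j) = Z j := by
    intro j hj
    refine Finset.eq_of_subset_of_card_le ?_ ?_
    · intro v hv
      obtain ⟨z, hz, rfl⟩ := Finset.mem_image.1 hv
      exact (hφ j hj).2 z hz
    · rw [Finset.card_image_of_injOn (hφ j hj).1, hc j hj]
  -- One path per vertex of `Z 0`, running through all the parts, and a one-vertex path per leftover
  -- vertex.
  refine ⟨Z 0 ∪ (W \ U), fun v => if v ∈ Z 0 then φ (q - 1) v else v,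
    fun v => if v ∈ Z 0 then ∑ j ∈ Finset.range q, {φ j v} else {v}, ?_, ?_, ?_⟩
  · intro v hv
    by_cases hv0 : v ∈ Z 0
    · simp only [hv0, if_true]
      have := HasPath.sum (s := fun j => φ j v) (t := fun j => φ j v) (E := G) (q - 1)
        (fun i _ => HasPath.singleton G _) (fun i hi => hφE i (by omega) v hv0)
      simpa only [hφ0, show q - 1 + 1 = q by omega] using this
    · simp only [hv0, if_false]
      exact HasPath.singleton G v
  · rw [Finset.sum_union hZ0]
    have h1 : ∑ v ∈ Z 0, (if v ∈ Z 0 then ∑ j ∈ Finset.range q, ({φ j v} : Multiset V) else {v}) =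
        ∑ v ∈ U, {v} := by
      rw [hU, Finset.sum_biUnion hpd, Finset.sum_congr rfl fun v hv => if_pos hv, Finset.sum_comm]
      refine Finset.sum_congr rfl fun j hj => ?_
      rw [Finset.mem_range] at hj
      rw [sum_singleton_eq_val_image (hφ j hj).1, himg j hj, Finset.sum_multiset_singleton]
    have h2 : ∑ v ∈ W \ U, (if v ∈ Z 0 then ∑ j ∈ Finset.range q, ({φ j v} : Multiset V) else {v}) =
        ∑ v ∈ W \ U, {v} :=
      Finset.sum_congr rfl fun v hv => if_neg (Finset.disjoint_right.1 hZ0 hv)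
    rw [h1, h2, add_comm, Finset.sum_sdiff hUW, Finset.sum_multiset_singleton]
  · have h1 : U.card = q * (Z 0).card := by
      rw [hU, Finset.card_biUnion fun i hi j hj hij => hpd hi hj hij,
        Finset.sum_congr rfl fun j hj => hc j (Finset.mem_range.1 hj)]
      simp
    have h2 := Finset.card_sdiff_of_subset hUW
    have h3 := Finset.card_le_card hUW
    have h4 := Finset.card_union_le (Z 0) (W \ U)
    omega

/-- With `u c = z (2 * c + 1)` and `v c = z (2 * c + 2)`, the odd steps of the alternating closed
walk are the arcs from `v c` to `u c`, and the even steps those from `v c` to `u (c + 1)`. The first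
and last steps are the arcs out of and into `x`; both have the forward direction because `N` is odd.
The links `w c` supply the segments of the absorber. -/
theorem hasPath_zigzag {z : ℕ → V} {x : V} {w : ℕ → ℕ → V} {P P' : ℕ → Finset V}
    (hΛ : 0 < Λ) (hN : N = 4 * Λ + 3)
    (hz : IsLink (fun j => if Even j then G else flip G) N P x x z)
    (hw : ∀ c < 2 * Λ, IsLink (fun _ => G) N P' (z (2 * c + 1)) (z (2 * (c + 1) + 2)) (w c))
    (S : Finset V) :
    HasPath G (z 2) (z (4 * Λ + 1)) (innerVertices N z +
      ∑ c ∈ Finset.range (2 * Λ), innerVertices N (w c) + if x ∈ S then {x} else 0) := by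
  have hvu : ∀ c ≤ 2 * Λ, G (z (2 * c + 2)) (z (2 * c + 1)) := by
    intro c hc
    have := hz.rel (2 * c + 1) (by omega)
    rwa [if_neg (by simp)] at this
  have hvu' : ∀ c < 2 * Λ, G (z (2 * c + 2)) (z (2 * (c + 1) + 1)) := by
    intro c hc
    have := hz.rel (2 * c + 2) (by omega)
    rwa [if_pos (by simp [Nat.even_add])] at this
  have hvx : G (z (2 * (2 * Λ) + 2)) x := by
    have := hz.rel (4 * Λ + 2) (by omega)
    rw [if_pos ⟨2 * Λ + 1, by ring⟩, show 4 * Λ + 2 + 1 = N by omega, hz.last] at this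
    rwa [show 2 * (2 * Λ) + 2 = 4 * Λ + 2 by ring]
  have hxu : G x (z (2 * 0 + 1)) := by
    have := hz.rel 0 (by omega)
    rwa [if_pos (by simp), hz.zero] at this
  have hM : ∀ c < 2 * Λ, HasPath G (z (2 * c + 1)) (z (2 * (c + 1) + 2))
      ({z (2 * c + 1)} + innerVertices N (w c) + {z (2 * (c + 1) + 2)}) := fun c hc =>
    (HasPath.singleton G _).link (by omega) (hw c hc) (HasPath.singleton G _)
  have hsum : ({z (2 * 0 + 2)} : Multiset V) + ∑ c ∈ Finset.range (2 * Λ),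
      ({z (2 * c + 1)} + innerVertices N (w c) + {z (2 * (c + 1) + 2)}) +
      {z (2 * (2 * Λ) + 1)} =
      innerVertices N z + ∑ c ∈ Finset.range (2 * Λ), innerVertices N (w c) := by
    rw [innerVertices, show N - 1 = 2 * (2 * Λ + 1) by omega, sum_range_two_mul _ (2 * Λ + 1),
      Finset.sum_range_succ, Finset.sum_range_succ' (fun e => ({z (2 * e + 1 + 1)} : Multiset V)),
      Finset.sum_add_distrib, Finset.sum_add_distrib]
    abel
  have h0 := hasPath_absorber (u := fun c => z (2 * c + 1)) (v := fun c => z (2 * c + 2)) hΛ hM hvu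
  have h1 := hasPath_absorber_insert (u := fun c => z (2 * c + 1)) (v := fun c => z (2 * c + 2))
    hΛ hM hvu' hvx hxu
  simp only [hsum] at h0 h1
  rw [show 4 * Λ + 1 = 2 * (2 * Λ) + 1 by ring]
  by_cases hx : x ∈ S
  · simpa only [hx, if_true] using h1
  · simpa only [hx, if_false, add_zero] using h0

/-- Gadgets are chained: each uses `2 * Λ` internal links, and one further link leads to the next
gadget, whence the numbering `i * (2 * Λ + 1) + c`. -/
theorem hasPath_absorbing {z : ℕ → ℕ → V} {x : ℕ → V} {w : ℕ → ℕ → V} {P P' : ℕ → Finset V}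
    (hΛ : 0 < Λ) (hN : N = 4 * Λ + 3) (m : ℕ)
    (hz : ∀ i ≤ m, IsLink (fun j => if Even j then G else flip G) N P (x i) (x i) (z i))
    (hw : ∀ i c, c < 2 * Λ + 1 → i * (2 * Λ + 1) + c < m * (2 * Λ + 1) + 2 * Λ →
      IsLink (fun _ => G) N P' (z i (2 * c + 1))
        (if c < 2 * Λ then z i (2 * (c + 1) + 2) else z (i + 1) 2) (w (i * (2 * Λ + 1) + c)))
    (S : Finset V) :
    HasPath G (z 0 2) (z m (4 * Λ + 1)) (∑ i ∈ Finset.range (m + 1), innerVertices N (z i) +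
      ∑ n ∈ Finset.range (m * (2 * Λ + 1) + 2 * Λ), innerVertices N (w n) +
      ∑ i ∈ Finset.range (m + 1), if x i ∈ S then {x i} else 0) := by
  have hblock : ∀ i ≤ m, HasPath G (z i 2) (z i (4 * Λ + 1)) (innerVertices N (z i) +
      ∑ c ∈ Finset.range (2 * Λ), innerVertices N (w (i * (2 * Λ + 1) + c)) +
        if x i ∈ S then {x i} else 0) := by
    intro i hi
    refine hasPath_zigzag (w := fun c => w (i * (2 * Λ + 1) + c)) (P' := P') hΛ hN (hz i hi) ?_ S
    intro c hc
    have := hw i c (by omega) (by nlinarith)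
    rwa [if_pos hc] at this
  induction m with
  | zero => simpa using hblock 0 le_rfl
  | succ m ih =>
    have h1 := ih (fun i hi => hz i (by omega)) (fun i c hc h => hw i c hc (by nlinarith))
      (fun i hi => hblock i (by omega))
    have h2 := hw m (2 * Λ) (by omega) (by nlinarith)
    rw [if_neg (by omega), show 2 * (2 * Λ) + 1 = 4 * Λ + 1 by ring] at h2
    have h3 := h1.link (by omega) h2 (hblock (m + 1) le_rfl)
    convert h3 using 1
    rw [show (m + 1) * (2 * Λ + 1) + 2 * Λ = m * (2 * Λ + 1) + 2 * Λ + 1 + 2 * Λ by ring,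
      Finset.sum_range_add _ (m * (2 * Λ + 1) + 2 * Λ + 1), Finset.sum_range_succ _ (m + 1),
      Finset.sum_range_succ _ (m + 1), Finset.sum_range_succ _ (m * (2 * Λ + 1) + 2 * Λ),
      show (m + 1) * (2 * Λ + 1) = m * (2 * Λ + 1) + 2 * Λ + 1 by ring]
    abel

end Assembly

/-! ### The absorbing path and the Hamilton cycle. -/

section Assembly
open scoped Classical
variable {V : Type*} {G : V → V → Prop} {τ κ Λ N r : ℕ}

theorem exists_enumeration (T : Finset V) (v₀ : V) :
    ∃ x : ℕ → V, Set.InjOn x (Finset.range T.card) ∧ (Finset.range T.card).image x = T := by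
  let x : ℕ → V := fun i => if h : i < T.card then T.equivFin.symm ⟨i, h⟩ else v₀
  have hinj : Set.InjOn x (Finset.range T.card) := by
    intro i hi j hj h
    simp only [Finset.coe_range, Set.mem_Iio] at hi hj
    simp only [x, hi, hj, dif_pos] at h
    simpa using T.equivFin.symm.injective (Subtype.ext h)
  refine ⟨x, hinj, Finset.eq_of_subset_of_card_le ?_ ?_⟩
  · intro v hv
    obtain ⟨i, hi, rfl⟩ := Finset.mem_image.1 hv
    rw [Finset.mem_range] at hi
    simp only [x, hi, dif_pos]
    exact (T.equivFin.symm ⟨i, hi⟩).2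
  · rw [Finset.card_image_of_injOn hinj, Finset.card_range]

theorem add_val_eq_union_val {A B : Finset V} (h : Disjoint A B) : A.val + B.val = (A ∪ B).val := by
  rw [← Finset.disjUnion_eq_union A B h]; rfl

theorem injOn_of_mem_of_nodup_sum {ι : Type*} {I : Finset ι} {M : ι → Multiset V}
    (hM : (∑ i ∈ I, M i).Nodup) {f : ι → V} (hf : ∀ i ∈ I, f i ∈ M i) : Set.InjOn f I := by
  intro i hi j hj h
  by_contra hne
  have h1 := Multiset.nodup_iff_count_le_one.1 hM (f i)
  rw [Multiset.count_sum'] at h1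
  have h2 : ∑ l ∈ {i, j}, Multiset.count (f i) (M l) ≤ ∑ l ∈ I, Multiset.count (f i) (M l) := by
    refine Finset.sum_le_sum_of_subset ?_
    intro l hl
    rcases Finset.mem_insert.1 hl with rfl | hl
    · exact hi
    · rw [Finset.mem_singleton.1 hl]; exact hj
  rw [Finset.sum_pair hne] at h2
  have h3 := Multiset.count_pos.2 (hf i hi)
  have h4 : 0 < Multiset.count (f i) (M j) := by rw [h]; exact Multiset.count_pos.2 (hf j hj)
  omega

/-- A path that can absorb any subset of `R`. -/
theorem exists_absorbing_path [Fintype V] {R S' : Finset V} {Lz Lw : ℕ → ℕ → Finset V} {κ' : ℕ}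
    (hΛ : 0 < Λ) (hτ : 0 < τ) (hV : Fintype.card V ≤ 2 ^ Λ) (hN : N = 4 * Λ + 3)
    (hR : R.Nonempty) (hz : IsLayerFamily G τ κ r N Lz R) (hw : IsLayerFamily G τ κ' r N Lw S')
    (hS' : layerUnion r N Lz ⊆ S') (hκ : R.card ≤ κ) (hκ' : R.card * (2 * Λ + 1) ≤ κ')
    (hr : R.card * (2 * Λ + 1) < 2 ^ r) :
    ∃ (s t : V) (A : Finset V), A ⊆ layerUnion r N Lz ∪ layerUnion r N Lw ∧
      ∀ S ⊆ R, HasPath G s t (A.val + S.val) := by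
  obtain ⟨v₀, hv₀⟩ := hR
  obtain ⟨m, hm⟩ : ∃ m, R.card = m + 1 := ⟨R.card - 1, by have := Finset.card_pos.2 ⟨v₀, hv₀⟩; omega⟩
  obtain ⟨x, hx, hxR⟩ := exists_enumeration R v₀
  rw [hm] at hx hxR hκ hκ' hr
  have hxm : ∀ i ∈ Finset.range (m + 1), x i ∈ R := by
    intro i hi; rw [← hxR]; exact Finset.mem_image_of_mem x hi
  obtain ⟨z, P, Tz, hzl, hzm, hzi, hTz, hTzs⟩ := hz.exists_links
    (E := fun j => if Even j then G else flip G) hτ hV (by omega)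
    (fun j => by by_cases h : Even j <;> simp [h]) hxm hxm hx hx (by simpa using hκ)
    (by rw [Finset.card_range]; nlinarith)
  set k := 2 * Λ + 1 with hk
  have hdiv : ∀ n < (m + 1) * k, n / k ∈ Finset.range (m + 1) := by
    intro n hn
    rw [Finset.mem_range]
    exact Nat.div_lt_of_lt_mul (by rwa [mul_comm])
  have hmod : ∀ n, n % k < k := fun n => Nat.mod_lt _ (by omega)
  have hI : ∀ n ∈ Finset.range (m * k + 2 * Λ), n + 1 < (m + 1) * k := by
    intro n hn
    rw [Finset.mem_range] at hn
    rw [add_mul]; omega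
  -- All internal and connecting links are found at once. Passing from `n` to `n + 1` in quotient
  -- and remainder makes the last link of a gadget end at the start of the next one; there is no
  -- link after the last gadget.
  obtain ⟨w, P', Tw, hwl, hwm, hwi, hTw, hTws⟩ := hw.exists_links (E := fun _ => G)
    (I := Finset.range (m * k + 2 * Λ))
    (a := fun n => z (n / k) (2 * (n % k) + 1))
    (b := fun n => z ((n + 1) / k) (2 * ((n + 1) % k) + 2)) hτ hV (by omega) (fun _ => Or.inl rfl)
    (fun n hn => hS' (hzm _ (hdiv n (by have := hI n hn; omega)) _ (by omega)
      (by have := hmod n; omega)))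
    (fun n hn => hS' (hzm _ (hdiv (n + 1) (hI n hn)) _ (by omega)
      (by have := hmod (n + 1); omega)))
    (by
      intro n hn n' hn' h
      have h1 := hmod n
      have h2 := hmod n'
      obtain ⟨h3, h4⟩ := hzi _ (hdiv n (by have := hI n hn; omega)) _ (by omega) (by omega) _
        (hdiv n' (by have := hI n' hn'; omega)) _ (by omega) (by omega) h
      rw [← Nat.div_add_mod n k, ← Nat.div_add_mod n' k, h3, show n % k = n' % k by omega])
    (by
      intro n hn n' hn' h
      have h1 := hmod (n + 1)
      have h2 := hmod (n' + 1)
      obtain ⟨h3, h4⟩ := hzi _ (hdiv (n + 1) (hI n hn)) _ (by omega) (by omega) _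
        (hdiv (n' + 1) (hI n' hn')) _ (by omega) (by omega) h
      have h5 := Nat.div_add_mod (n + 1) k
      have h6 := Nat.div_add_mod (n' + 1) k
      rw [h3, show (n + 1) % k = (n' + 1) % k by omega] at h5
      omega)
    (by rw [Finset.card_range]; rw [add_mul] at hκ'; omega)
    (by rw [Finset.card_range]; rw [add_mul] at hr; omega)
  have hdisj : Disjoint Tz Tw := by
    rw [Finset.disjoint_left]
    intro v hv hv'
    obtain ⟨ρ, hρ, j, h1, h2, hvj⟩ := mem_layerUnion.1 (hTw hv')
    exact Finset.disjoint_left.1 (hw.disj_left ρ hρ j h1 h2) (hS' (hTz hv)) hvj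
  refine ⟨z 0 2, z m (4 * Λ + 1), Tz ∪ Tw, Finset.union_subset_union hTz hTw, fun S hS => ?_⟩
  have h := hasPath_absorbing (P' := P') (w := w) hΛ hN m
    (fun i hi => hzl i (by simp; omega)) (by
      intro i c hc hic
      have := hwl (i * k + c) (by simpa using hic)
      have h1 : (i * k + c) / k = i := by
        rw [mul_comm, Nat.mul_add_div (by omega), Nat.div_eq_of_lt hc, add_zero]
      have h2 : (i * k + c) % k = c := by
        rw [mul_comm, Nat.mul_add_mod, Nat.mod_eq_of_lt hc]
      rw [h1, h2] at this
      convert this using 1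
      split_ifs with hcΛ
      · have h3 : (i * k + c + 1) / k = i := by
          rw [add_assoc, mul_comm, Nat.mul_add_div (by omega), Nat.div_eq_of_lt (by omega), add_zero]
        have h4 : (i * k + c + 1) % k = c + 1 := by
          rw [add_assoc, mul_comm, Nat.mul_add_mod, Nat.mod_eq_of_lt (by omega)]
        rw [h3, h4]
      · obtain rfl : c = 2 * Λ := by omega
        have h5 : i * k + 2 * Λ + 1 = (i + 1) * k := by rw [hk]; ring
        rw [h5, Nat.mul_div_cancel _ (by omega), Nat.mul_mod_left]) S
  have hS2 : (∑ i ∈ Finset.range (m + 1), if x i ∈ S then ({x i} : Multiset V) else 0) = S.val := by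
    rw [← Finset.sum_image (f := fun v => if v ∈ S then ({v} : Multiset V) else 0) hx, hxR,
      Finset.sum_ite_mem, Finset.sum_multiset_singleton, Finset.inter_eq_right.2 hS]
  rwa [hTzs, hTws, hS2, add_val_eq_union_val hdisj] at h

theorem hasPath_sum_links {s t : ℕ → V} {M : ℕ → Multiset V} {w : ℕ → ℕ → V} {P : ℕ → Finset V}
    (hN : 2 ≤ N) (n : ℕ) (h : ∀ i ≤ n, HasPath G (s i) (t i) (M i))
    (hw : ∀ i < n, IsLink (fun _ => G) N P (t i) (s (i + 1)) (w i)) :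
    HasPath G (s 0) (t n) (∑ i ∈ Finset.range (n + 1), M i +
      ∑ i ∈ Finset.range n, innerVertices N (w i)) := by
  induction n with
  | zero => simpa using h 0 le_rfl
  | succ n ih =>
    have := (ih (fun i hi => h i (by omega)) (fun i hi => hw i (by omega))).link hN
      (hw n (by omega)) (h (n + 1) le_rfl)
    convert this using 1
    rw [Finset.sum_range_succ _ (n + 1), Finset.sum_range_succ (fun i => innerVertices N (w i))]
    abel

/-- An absorbing path and a path cover of the remaining vertices are linked to a Hamilton cycle
through the reservoir `R`. -/
theorem isHamiltonian_of_absorbing [Fintype V] {D : Digraph V} {R A : Finset V}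
    {L : ℕ → ℕ → Finset V} (hτ : 0 < τ) (hV : Fintype.card V ≤ 2 ^ Λ) (hN : 4 * Λ + 2 ≤ N)
    (hL : IsLayerFamily D.Adj τ κ r N L (Finset.univ \ R)) (hLR : layerUnion r N L ⊆ R)
    (hAR : Disjoint A R) {s t : V} (habs : ∀ S ⊆ R, HasPath D.Adj s t (A.val + S.val))
    {T : Finset V} {e : V → V} {M : V → Multiset V} (hT : ∀ v ∈ T, HasPath D.Adj v (e v) (M v))
    (hsum : ∑ v ∈ T, M v = (Finset.univ \ (A ∪ R)).val) (hTκ : T.card + 1 ≤ κ)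
    (hr : T.card + 1 < 2 ^ r) : D.IsHamiltonian := by
  obtain ⟨x, hx, hxT⟩ := exists_enumeration T s
  set n := T.card with hn
  let σ : ℕ → V := fun i => if i = 0 then s else x (i - 1)
  let ε : ℕ → V := fun i => if i = 0 then t else e (x (i - 1))
  let B : Finset V → ℕ → Multiset V := fun S i => if i = 0 then A.val + S.val else M (x (i - 1))
  have hB : ∀ S ⊆ R, ∀ i ≤ n, HasPath D.Adj (σ i) (ε i) (B S i) := by
    intro S hS i hi
    rcases Nat.eq_zero_or_pos i with rfl | h
    · simpa [σ, ε, B] using habs S hS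
    · simp only [σ, ε, B, h.ne', if_false]
      refine hT _ ?_
      rw [← hxT]
      exact Finset.mem_image_of_mem x (by simp; omega)
  have hBsum : ∀ S, ∑ i ∈ Finset.range (n + 1), B S i =
      (Finset.univ \ R).val + S.val := by
    intro S
    have h1 : ∑ i ∈ Finset.range n, M (x i) = ∑ v ∈ T, M v := by
      conv_rhs => rw [← hxT, Finset.sum_image hx]
    have h2 : Disjoint (Finset.univ \ (A ∪ R)) A :=
      Finset.disjoint_sdiff.symm.mono_right Finset.subset_union_left
    have h3 : Finset.univ \ (A ∪ R) ∪ A = Finset.univ \ R := by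
      ext v
      have h4 : v ∈ A → v ∉ R := fun h => Finset.disjoint_left.1 hAR h
      simp only [Finset.mem_union, Finset.mem_sdiff, Finset.mem_univ, true_and]
      tauto
    rw [Finset.sum_range_succ']
    simp only [B, Nat.add_eq_zero_iff, one_ne_zero, and_false, if_false, Nat.add_sub_cancel,
      if_true]
    rw [h1, hsum, ← add_assoc, add_val_eq_union_val h2, h3]
  -- With nothing absorbed the pieces partition the complement of `R`, so their first vertices are
  -- distinct, and so are their last vertices.
  have hnd : (∑ i ∈ Finset.range (n + 1), B ∅ i).Nodup := by
    rw [hBsum]; simpa using (Finset.univ \ R).nodup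
  have hσB : ∀ i ∈ Finset.range (n + 1), σ i ∈ B ∅ i := fun i hi =>
    (hB ∅ (by simp) i (by simp at hi; omega)).mem_left
  have hεB : ∀ i ∈ Finset.range (n + 1), ε i ∈ B ∅ i := fun i hi =>
    (hB ∅ (by simp) i (by simp at hi; omega)).mem_right
  have hmem : ∀ i ∈ Finset.range (n + 1), ∀ v ∈ B ∅ i, v ∈ Finset.univ \ R := by
    intro i hi v hv
    have h1 : v ∈ ∑ i ∈ Finset.range (n + 1), B ∅ i := Multiset.mem_sum.2 ⟨i, hi, hv⟩
    rw [hBsum, Finset.empty_val, add_zero] at h1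
    exact h1
  have hσ := injOn_of_mem_of_nodup_sum hnd hσB
  have hε := injOn_of_mem_of_nodup_sum hnd hεB
  have hnext : ∀ i, (i + 1) % (n + 1) ∈ Finset.range (n + 1) := fun i => by
    rw [Finset.mem_range]; exact Nat.mod_lt _ (by omega)
  obtain ⟨w, P, J, hwl, -, -, hJ, hJs⟩ := hL.exists_links (E := fun _ => D.Adj)
    (I := Finset.range (n + 1)) (a := ε) (b := fun i => σ ((i + 1) % (n + 1))) hτ hV hN
    (fun _ => Or.inl rfl) (fun i hi => hmem i hi _ (hεB i hi))
    (fun i hi => hmem _ (hnext i) _ (hσB _ (hnext i))) hε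
    (by
      intro i hi j hj h
      have h1 := hσ (hnext i) (hnext j) h
      simp only [Finset.coe_range, Set.mem_Iio] at hi hj
      have h2 : i + 1 ≡ j + 1 [MOD n + 1] := h1
      exact Nat.ModEq.eq_of_lt_of_lt (Nat.ModEq.add_right_cancel' 1 h2) hi hj)
    (by simpa using hTκ) (by simpa using hr)
  have hJR : J ⊆ R := hJ.trans hLR
  -- The ends of the absorbing path do not depend on what it absorbs. Hence the links, with inner
  -- vertices `J`, can be fixed first and `R \ J` absorbed afterwards.
  have h1 := hasPath_sum_links (P := P) (w := w) (s := σ) (t := ε) (by omega : 2 ≤ N) n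
    (hB (R \ J) Finset.sdiff_subset) (by
      intro i hi
      have := hwl i (by simp; omega)
      simpa only [Nat.mod_eq_of_lt (show i + 1 < n + 1 by omega)] using this)
  have hlast := hwl n (by simp)
  simp only [Nat.mod_self] at hlast
  have hE0 := hlast.rel 0 (by omega)
  have hEl := hlast.rel (N - 1) (by omega)
  rw [hlast.zero] at hE0
  rw [show N - 1 + 1 = N by omega, hlast.last] at hEl
  have h2 := h1.append hE0 (hlast.hasPath_inner (by omega))
  rw [add_assoc, ← Finset.sum_range_succ, hBsum, hJs, add_assoc,
    add_val_eq_union_val Finset.sdiff_disjoint, Finset.sdiff_union_of_subset hJR,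
    add_val_eq_union_val Finset.sdiff_disjoint,
    Finset.sdiff_union_of_subset (Finset.subset_univ R)] at h2
  exact h2.isHamiltonian hEl

end Assembly

/-! ### Building the reservoir and its absorber from parts. -/

section Layers
open scoped Classical
variable {V : Type*} {G : V → V → Prop} {τ Λ N : ℕ}

theorem mul_add_injective {c a a' t t' : ℕ} (ht : t < c) (ht' : t' < c)
    (h : a * c + t = a' * c + t') : a = a' ∧ t = t' := by
  have h1 : (a * c + t) / c = a := by
    rw [mul_comm, Nat.mul_add_div (by omega), Nat.div_eq_of_lt ht, add_zero]
  have h2 : (a' * c + t') / c = a' := by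
    rw [mul_comm, Nat.mul_add_div (by omega), Nat.div_eq_of_lt ht', add_zero]
  have h3 : a = a' := by rw [← h1, h, h2]
  subst h3
  exact ⟨rfl, by omega⟩

/-- Parts any union of which expands yield a reservoir and a path absorbing it, within the first
`Λ * N * c` parts. -/
theorem exists_reservoir_absorber [Fintype V] {P : ℕ → Finset V} {q m K c c₁ c₂ : ℕ}
    (hΛ : 0 < Λ) (hτ : 0 < τ) (hV : Fintype.card V < 2 ^ Λ) (hN : N = 4 * Λ + 3)
    (hK : 0 < K) (hm : 0 < m) (hc : c = 1 + c₁ + c₂) (hq : Λ * N * c ≤ q)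
    (hc₁ : K * (Λ * N) ≤ c₁) (hc₂ : K * (Λ * N * (2 * Λ + 1)) ≤ c₂)
    (hP : ∀ i < q, ∀ j < q, i ≠ j → Disjoint (P i) (P j)) (hPc : ∀ i < q, (P i).card = m)
    (hexp : ∀ J ⊆ Finset.range q, J.Nonempty → ∀ κ, K * κ ≤ J.card * m →
      IsBiExpander G τ κ (J.biUnion P)) :
    ∃ (R A : Finset V) (L : ℕ → ℕ → Finset V) (s t : V),
      IsLayerFamily G τ (m / K) Λ N L (Finset.univ \ R) ∧ layerUnion Λ N L ⊆ R ∧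
      Disjoint A R ∧ A ∪ R ⊆ (Finset.range (Λ * N * c)).biUnion P ∧
      ∀ S ⊆ R, HasPath G s t (A.val + S.val) := by
  -- Each layer position `(ρ, j)` owns `c` consecutive parts: one for the reservoir, `c₁` for the
  -- alternating walks and `c₂` for the links of the gadgets. The sizes of `c₁` and `c₂` provide for
  -- `R.card` and `R.card * (2 * Λ + 1)` walks respectively.
  let idx : ℕ → ℕ → ℕ → ℕ := fun ρ j t => (ρ * N + j) * c + t
  have hidx : ∀ ρ < Λ, ∀ j < N, ∀ t < c, idx ρ j t < Λ * N * c := by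
    intro ρ hρ j hj t ht
    have h1 : ρ * N + j + 1 ≤ Λ * N := by
      calc ρ * N + j + 1 ≤ (ρ + 1) * N := by rw [add_mul]; omega
        _ ≤ Λ * N := Nat.mul_le_mul_right _ hρ
    calc idx ρ j t < (ρ * N + j + 1) * c := by simp only [idx]; rw [add_mul _ 1]; omega
      _ ≤ Λ * N * c := Nat.mul_le_mul_right _ h1
  have hidx_inj : ∀ ρ ρ', ∀ j < N, ∀ j' < N, ∀ t < c, ∀ t' < c, idx ρ j t = idx ρ' j' t' →
      ρ = ρ' ∧ j = j' ∧ t = t' := by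
    intro ρ ρ' j hj j' hj' t ht t' ht' h
    obtain ⟨h1, h2⟩ := mul_add_injective ht ht' h
    obtain ⟨h3, h4⟩ := mul_add_injective hj hj' h1
    exact ⟨h3, h4, h2⟩
  let lay : Finset ℕ → ℕ → ℕ → Finset V := fun T ρ j => (T.image (idx ρ j)).biUnion P
  have hlay_disj : ∀ T ⊆ Finset.range c, ∀ T' ⊆ Finset.range c, ∀ ρ < Λ, ∀ ρ' < Λ, ∀ j < N,
      ∀ j' < N, (Disjoint T T' ∨ (ρ, j) ≠ (ρ', j')) → Disjoint (lay T ρ j) (lay T' ρ' j') := by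
    intro T hT T' hT' ρ hρ ρ' hρ' j hj j' hj' h
    simp only [lay]
    rw [Finset.disjoint_biUnion_left]
    intro i hi
    rw [Finset.disjoint_biUnion_right]
    intro i' hi'
    obtain ⟨t, ht, rfl⟩ := Finset.mem_image.1 hi
    obtain ⟨t', ht', rfl⟩ := Finset.mem_image.1 hi'
    have htc := Finset.mem_range.1 (hT ht)
    have htc' := Finset.mem_range.1 (hT' ht')
    refine hP _ ((hidx ρ hρ j hj t htc).trans_le hq) _
      ((hidx ρ' hρ' j' hj' t' htc').trans_le hq) fun heq => ?_
    obtain ⟨rfl, rfl, rfl⟩ := hidx_inj _ _ _ hj _ hj' _ htc _ htc' heq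
    rcases h with h | h
    · exact Finset.disjoint_left.1 h ht ht'
    · exact h rfl
  have hlay_sub : ∀ T ⊆ Finset.range c, ∀ ρ < Λ, ∀ j < N,
      lay T ρ j ⊆ (Finset.range (Λ * N * c)).biUnion P := by
    intro T hT ρ hρ j hj
    refine Finset.biUnion_subset_biUnion_of_subset_left _ fun i hi => ?_
    obtain ⟨t, ht, rfl⟩ := Finset.mem_image.1 hi
    exact Finset.mem_range.2 (hidx ρ hρ j hj t (Finset.mem_range.1 (hT ht)))
  have himg : ∀ T ⊆ Finset.range c, ∀ ρ < Λ, ∀ j < N, T.image (idx ρ j) ⊆ Finset.range q ∧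
      (T.image (idx ρ j)).card = T.card := by
    intro T hT ρ hρ j hj
    refine ⟨fun i hi => ?_, Finset.card_image_of_injective _ fun t t' h => by simpa [idx] using h⟩
    obtain ⟨t, ht, rfl⟩ := Finset.mem_image.1 hi
    exact Finset.mem_range.2 ((hidx ρ hρ j hj t (Finset.mem_range.1 (hT ht))).trans_le hq)
  have hlay_card : ∀ T ⊆ Finset.range c, ∀ ρ < Λ, ∀ j < N, (lay T ρ j).card = T.card * m := by
    intro T hT ρ hρ j hj
    obtain ⟨h1, h2⟩ := himg T hT ρ hρ j hj
    rw [Finset.card_biUnion fun i hi i' hi' hne =>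
        hP i (Finset.mem_range.1 (h1 hi)) i' (Finset.mem_range.1 (h1 hi')) hne,
      Finset.sum_congr rfl fun i hi => hPc i (Finset.mem_range.1 (h1 hi)), Finset.sum_const, h2,
      smul_eq_mul]
  have hfam : ∀ T ⊆ Finset.range c, T.Nonempty → ∀ κ, K * κ ≤ T.card * m → ∀ S : Finset V,
      (∀ ρ < Λ, ∀ j, 0 < j → j < N → Disjoint S (lay T ρ j)) →
      IsLayerFamily G τ κ Λ N (lay T) S := by
    intro T hT hTne κ hκ S hS
    refine ⟨fun ρ hρ j _ hj => ?_, fun ρ hρ j _ hj ρ' hρ' j' _ hj' hne => ?_, hS⟩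
    · obtain ⟨h1, h2⟩ := himg T hT ρ hρ j hj
      exact hexp _ h1 (hTne.image _) κ (by rwa [h2])
    · exact hlay_disj T hT T hT ρ hρ ρ' hρ' j hj j' hj' (Or.inr hne)
  have hN0 : 0 < Λ * N := Nat.mul_pos hΛ (by omega)
  have hKN : 0 < K * (Λ * N) := Nat.mul_pos hK hN0
  have hKN' : 0 < K * (Λ * N * (2 * Λ + 1)) := Nat.mul_pos hK (Nat.mul_pos hN0 (by omega))
  have hT₀ : ({0} : Finset ℕ) ⊆ Finset.range c := by simp; omega
  have hT₁ : Finset.Ico 1 (1 + c₁) ⊆ Finset.range c := by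
    intro i hi; simp at hi ⊢; omega
  have hT₂ : Finset.Ico (1 + c₁) c ⊆ Finset.range c := by
    intro i hi; simp at hi ⊢; omega
  have hd₀₁ : Disjoint {0} (Finset.Ico 1 (1 + c₁)) := by simp
  have hd₀₂ : Disjoint {0} (Finset.Ico (1 + c₁) c) := by simp
  have hd₁₂ : Disjoint (Finset.Ico 1 (1 + c₁)) (Finset.Ico (1 + c₁) c) :=
    Finset.Ico_disjoint_Ico_consecutive _ _ _
  have hunion : ∀ T ⊆ Finset.range c, ∀ T' ⊆ Finset.range c, Disjoint T T' → ∀ ρ < Λ, ∀ j, j < N →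
      Disjoint (layerUnion Λ N (lay T)) (lay T' ρ j) := by
    intro T hT T' hT' hTT ρ hρ j hj
    rw [Finset.disjoint_left]
    intro v hv hv'
    obtain ⟨ρ', hρ', j', _, hj', hv⟩ := mem_layerUnion.1 hv
    exact Finset.disjoint_left.1
      (hlay_disj T hT T' hT' ρ' hρ' ρ hρ j' hj' j hj (Or.inl hTT)) hv hv'
  set R := layerUnion Λ N (lay {0}) with hR
  have hRc : R.card ≤ Λ * N * m := by
    refine Finset.card_biUnion_le.trans ?_
    calc _ ≤ ∑ ρ ∈ Finset.range Λ, N * m := by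
          refine Finset.sum_le_sum fun ρ hρ => Finset.card_biUnion_le.trans ?_
          calc _ = ∑ j ∈ Finset.Ioo 0 N, m := by
                refine Finset.sum_congr rfl fun j hj => ?_
                rw [hlay_card _ hT₀ ρ (Finset.mem_range.1 hρ) j (Finset.mem_Ioo.1 hj).2]
                simp
            _ ≤ N * m := by
                rw [Finset.sum_const, smul_eq_mul, Nat.card_Ioo]
                exact Nat.mul_le_mul_right _ (by omega)
      _ = Λ * N * m := by simp [mul_assoc]
  have hRne : R.Nonempty := by
    have h1 := hlay_card {0} hT₀ 0 hΛ 1 (by omega)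
    rw [Finset.card_singleton, one_mul] at h1
    obtain ⟨v, hv⟩ := Finset.card_pos.1 (h1 ▸ hm)
    exact ⟨v, mem_layerUnion.2 ⟨0, hΛ, 1, by omega, by omega, hv⟩⟩
  have hz : IsLayerFamily G τ R.card Λ N (lay (Finset.Ico 1 (1 + c₁))) R := by
    refine hfam _ hT₁ ⟨1, by simp; omega⟩ _ ?_ _ fun ρ hρ j _ hj => hunion _ hT₀ _ hT₁ hd₀₁ ρ hρ j hj
    rw [Nat.card_Ico, Nat.add_sub_cancel_left]
    calc K * R.card ≤ K * (Λ * N * m) := Nat.mul_le_mul_left _ hRc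
      _ = K * (Λ * N) * m := by ring
      _ ≤ c₁ * m := Nat.mul_le_mul_right _ hc₁
  have hKw : K * (R.card * (2 * Λ + 1)) ≤ c₂ * m := by
    calc K * (R.card * (2 * Λ + 1)) ≤ K * (Λ * N * m * (2 * Λ + 1)) := by gcongr
      _ = K * (Λ * N * (2 * Λ + 1)) * m := by ring
      _ ≤ c₂ * m := Nat.mul_le_mul_right _ hc₂
  have hw : IsLayerFamily G τ (R.card * (2 * Λ + 1)) Λ N (lay (Finset.Ico (1 + c₁) c))
      (layerUnion Λ N (lay (Finset.Ico 1 (1 + c₁)))) := by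
    refine hfam _ hT₂ ⟨1 + c₁, by simp; omega⟩ _ ?_ _
      fun ρ hρ j _ hj => hunion _ hT₁ _ hT₂ hd₁₂ ρ hρ j hj
    rwa [Nat.card_Ico, show c - (1 + c₁) = c₂ by omega]
  -- The number of links is at most the size of one linking layer, hence at most the number of
  -- vertices; so `Λ` families suffice.
  have hr : R.card * (2 * Λ + 1) < 2 ^ Λ := by
    refine lt_of_le_of_lt ?_ hV
    have h1 := hlay_card (Finset.Ico (1 + c₁) c) hT₂ 0 hΛ 1 (by omega)
    rw [Nat.card_Ico, show c - (1 + c₁) = c₂ by omega] at h1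
    calc R.card * (2 * Λ + 1) ≤ K * (R.card * (2 * Λ + 1)) := Nat.le_mul_of_pos_left _ hK
      _ ≤ c₂ * m := hKw
      _ ≤ _ := by rw [← h1]; exact Finset.card_le_univ _
  obtain ⟨s, t, A, hA, habs⟩ := exists_absorbing_path hΛ hτ hV.le hN hRne hz hw
    (Finset.Subset.refl _) le_rfl le_rfl hr
  refine ⟨R, A, lay {0}, s, t, hfam _ hT₀ ⟨0, by simp⟩ _ ?_ _ ?_, Finset.Subset.refl _, ?_, ?_,
    habs⟩
  · simpa using Nat.mul_div_le m K
  · intro ρ hρ j h1 hj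
    refine Disjoint.mono_right ?_ Finset.sdiff_disjoint
    intro v hv
    exact mem_layerUnion.2 ⟨ρ, hρ, j, h1, hj, hv⟩
  · refine Disjoint.mono_left hA ?_
    rw [Finset.disjoint_left]
    intro v hv hvR
    obtain ⟨ρ, hρ, j, _, hj, hv'⟩ := mem_layerUnion.1 hvR
    rcases Finset.mem_union.1 hv with h | h
    · exact Finset.disjoint_left.1 (hunion _ hT₁ _ hT₀ hd₀₁.symm ρ hρ j hj) h hv'
    · exact Finset.disjoint_left.1 (hunion _ hT₂ _ hT₀ hd₀₂.symm ρ hρ j hj) h hv'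
  · have hlu : ∀ T ⊆ Finset.range c,
        layerUnion Λ N (lay T) ⊆ (Finset.range (Λ * N * c)).biUnion P := by
      intro T hT v hv
      obtain ⟨ρ, hρ, j, _, hj, hv⟩ := mem_layerUnion.1 hv
      exact hlay_sub T hT ρ hρ j hj hv
    exact Finset.union_subset (hA.trans (Finset.union_subset (hlu _ hT₁) (hlu _ hT₂))) (hlu _ hT₀)

end Layers

/-! ### Pseudorandom digraphs: expansion, partitions and parameters. -/

section Pseudorandom
open scoped Classical

theorem outDegIn_biUnion {V : Type*} (D : Digraph V) (v : V) {J : Finset ℕ} {P : ℕ → Finset V}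
    (h : ∀ i ∈ J, ∀ j ∈ J, i ≠ j → Disjoint (P i) (P j)) :
    D.outDegIn v (J.biUnion P) = ∑ i ∈ J, D.outDegIn v (P i) := by
  simp only [outDegIn]
  rw [Finset.filter_biUnion, Finset.card_biUnion]
  exact fun i hi j hj hij => Finset.disjoint_filter_filter (h i hi j hj hij)

theorem inDegIn_biUnion {V : Type*} (D : Digraph V) (v : V) {J : Finset ℕ} {P : ℕ → Finset V}
    (h : ∀ i ∈ J, ∀ j ∈ J, i ≠ j → Disjoint (P i) (P j)) :
    D.inDegIn v (J.biUnion P) = ∑ i ∈ J, D.inDegIn v (P i) := by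
  simp only [inDegIn]
  rw [Finset.filter_biUnion, Finset.card_biUnion]
  exact fun i hi j hj hij => Finset.disjoint_filter_filter (h i hi j hj hij)

theorem outDegIn_mono {V : Type*} (D : Digraph V) (v : V) {X Y : Finset V} (h : X ⊆ Y) :
    D.outDegIn v X ≤ D.outDegIn v Y :=
  Finset.card_le_card (Finset.filter_subset_filter _ h)

theorem inDegIn_mono {V : Type*} (D : Digraph V) (v : V) {X Y : Finset V} (h : X ⊆ Y) :
    D.inDegIn v X ≤ D.inDegIn v Y :=
  Finset.card_le_card (Finset.filter_subset_filter _ h)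

theorem biUnion_degree_le {V : Type*} {D : Digraph V} {P : ℕ → Finset V} {J : Finset ℕ} {d : ℝ}
    (hP : ∀ i ∈ J, ∀ j ∈ J, i ≠ j → Disjoint (P i) (P j))
    (hd : ∀ i ∈ J, ∀ v, d ≤ (D.outDegIn v (P i) : ℝ) ∧ d ≤ (D.inDegIn v (P i) : ℝ)) (v : V) :
    J.card * d ≤ (D.outDegIn v (J.biUnion P) : ℝ) ∧
      J.card * d ≤ (D.inDegIn v (J.biUnion P) : ℝ) := by
  rw [outDegIn_biUnion D v hP, inDegIn_biUnion D v hP]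
  push_cast
  rw [← nsmul_eq_mul]
  exact ⟨Finset.card_nsmul_le_sum _ _ _ fun i hi => (hd i hi v).1,
    Finset.card_nsmul_le_sum _ _ _ fun i hi => (hd i hi v).2⟩

variable {V : Type*} [Fintype V] {D : Digraph V}

/-- The threshold `τ` is where (P3) becomes available, and sets of size `5 * τ` are still within the
range of (P2). Twice the relative degree exceeds the density factor `1 + α / 2` by `α`, which leaves
room for the slack `κ`. -/
theorem IsPseudorandom.isBiExpander {α p : ℝ} (hD : D.IsPseudorandom α p) (hα : 0 < α)
    (hp : 0 < p) (hp2 : p ≤ 2) {l : ℝ} (hl : l = Real.log (Fintype.card V)) (hl0 : 0 < l)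
    (h1 : 5 * l ^ (1.1 : ℝ) + 10 ≤ l ^ 2) (h2 : 4 * l ^ (1.1 : ℝ) + 8 ≤ 10 * l ^ (2.1 : ℝ))
    {X : Finset V} {κ : ℕ} (hX : 10 * l ^ (2.1 : ℝ) ≤ X.card * p)
    (hκ : (2 + α) * κ < α * X.card)
    (hdeg : ∀ v, (1 / 2 + 3 / 4 * α) * X.card * p ≤ (D.outDegIn v X : ℝ) ∧
      (1 / 2 + 3 / 4 * α) * X.card * p ≤ (D.inDegIn v X : ℝ)) :
    IsBiExpander D.Adj ⌈l ^ (1.1 : ℝ) / p⌉₊ κ X := by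
  set τ := ⌈l ^ (1.1 : ℝ) / p⌉₊ with hτ
  have hlp : 0 < l ^ (1.1 : ℝ) := Real.rpow_pos_of_pos hl0 _
  have hlp2 : 0 < l ^ (2.1 : ℝ) := Real.rpow_pos_of_pos hl0 _
  have hτ0 : 0 < τ := Nat.ceil_pos.2 (by positivity)
  have hτp : τ * p ≤ l ^ (1.1 : ℝ) + 2 := by
    have := (Nat.ceil_lt_add_one (show 0 ≤ l ^ (1.1 : ℝ) / p by positivity)).le
    calc τ * p ≤ (l ^ (1.1 : ℝ) / p + 1) * p := by gcongr
      _ = l ^ (1.1 : ℝ) + p := by field_simp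
      _ ≤ _ := by linarith
  have hτle : ∀ n : ℕ, τ ≤ n → l ^ (1.1 : ℝ) / p ≤ n := fun n hn => Nat.ceil_le.1 hn
  have hsmall : ∀ Y : Finset V, Y.card ≤ 5 * τ →
      (pairCount D.Adj Y Y : ℝ) ≤ Y.card * l ^ (2.1 : ℝ) := by
    intro Y hY
    have h3 : (Y.card : ℝ) ≤ 5 * τ := by exact_mod_cast hY
    have := hD.arcsIn_le Y (by
      rw [← hl, le_div_iff₀ hp]
      nlinarith)
    rw [← hl] at this
    exact this
  have hlarge : ∀ Y Z : Finset V, Disjoint Y Z → τ ≤ Y.card → τ ≤ Z.card →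
      (pairCount D.Adj Y Z : ℝ) ≤ (1 + α / 2) * Y.card * Z.card * p := by
    intro Y Z hYZ hY hZ
    exact hD.arcsBetween_le Y Z hYZ (hl ▸ hτle _ hY) (hl ▸ hτle _ hZ)
  have hL : 4 * τ ≤ X.card := by
    have : (4 * τ : ℝ) * p ≤ X.card * p := by linarith
    exact_mod_cast le_of_mul_le_mul_right this hp
  have hds : 5 * l ^ (2.1 : ℝ) < (1 / 2 + 3 / 4 * α) * X.card * p := by
    have : 0 < α * (X.card * p) := mul_pos hα (by linarith)
    nlinarith
  have hdβ : (1 + α / 2) * (X.card + 2 * κ) * p < 2 * ((1 / 2 + 3 / 4 * α) * X.card * p) := by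
    have : (1 + α / 2) * (X.card + 2 * κ) < 2 * ((1 / 2 + 3 / 4 * α) * X.card) := by linarith
    nlinarith
  constructor
  · exact isExpander_of_pairCount hp (by positivity) hτ0 hL (fun v => (hdeg v).1) hsmall hlarge
      hlp2.le hds hdβ
  · refine isExpander_of_pairCount hp (by positivity) hτ0 hL (fun v => (hdeg v).2) ?_ ?_
      hlp2.le hds hdβ
    · intro Y hY
      rw [pairCount_flip]; exact hsmall Y hY
    · intro Y Z hYZ hY hZ
      rw [pairCount_flip]
      have := hlarge Z Y hYZ.symm hZ hY
      linarith

/-- Of the surplus `2 * a` in the degrees, one `a` covers the vertices left over by the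
equipartition and the other the random deviation `ε`. -/
theorem exists_good_parts (D : Digraph V) (W : Finset V) {q : ℕ} (hq : 0 < q) {c a x ε : ℝ}
    (hdeg : ∀ v, (c + 2 * a) * x ≤ (D.outDegIn v W : ℝ) ∧ (c + 2 * a) * x ≤ (D.inDegIn v W : ℝ))
    (hqa : q ≤ a * x) (hε : 0 ≤ ε) (hεa : ε * (c + a) ≤ a) (hx : 0 ≤ x) (hca : 0 ≤ c + a)
    (hprob : 2 * (Fintype.card V : ℝ) * q * Real.exp (-(ε ^ 2 / 2) * ((c + a) * x / q)) < 1) :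
    ∃ P : ℕ → Finset V, (∀ i < q, P i ⊆ W) ∧ (∀ i < q, ∀ j < q, i ≠ j → Disjoint (P i) (P j)) ∧
      (∀ i < q, (P i).card = W.card / q) ∧
      ∀ i < q, ∀ v, c * (x / q) ≤ (D.outDegIn v (P i) : ℝ) ∧
        c * (x / q) ≤ (D.inDegIn v (P i) : ℝ) := by
  let T : V × Bool → Finset V := fun t =>
    if t.2 then W.filter (fun y => D.Adj t.1 y) else W.filter (fun y => D.Adj y t.1)
  obtain ⟨L, hLW, hLd, hLc, hL⟩ := exists_equipartition W T
    (by rintro ⟨v, _ | _⟩ <;> exact Finset.filter_subset _ _) hq (ε := ε) (D := (c + a) * x) hε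
    (by positivity) (by
      rintro ⟨v, _ | _⟩
      · have := (hdeg v).2
        refine le_trans ?_ this
        linarith
      · have := (hdeg v).1
        refine le_trans ?_ this
        linarith)
    (by
      rw [Fintype.card_prod, Fintype.card_bool]
      push_cast
      linarith)
  have hlow : c * (x / q) ≤ (1 - ε) * ((c + a) * x / q) := by
    rw [mul_div_assoc, ← mul_assoc]
    refine mul_le_mul_of_nonneg_right ?_ (by positivity)
    nlinarith
  refine ⟨fun i => if h : i < q then L ⟨i, h⟩ else ∅, ?_, ?_, ?_, ?_⟩
  · intro i hi; simpa only [hi, dif_pos] using hLW _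
  · intro i hi j hj hij
    simp only [hi, hj, dif_pos]
    exact hLd _ _ (by simpa using hij)
  · intro i hi; simpa only [hi, dif_pos] using hLc _
  · intro i hi v
    simp only [hi, dif_pos]
    constructor
    · refine (hlow.trans (hL (v, true) ⟨i, hi⟩)).trans ?_
      rw [Nat.cast_le]
      refine Finset.card_le_card fun y hy => ?_
      simp only [T, if_true, Finset.mem_inter, Finset.mem_filter] at hy
      exact Finset.mem_filter.2 ⟨hy.2, hy.1.2⟩
    · refine (hlow.trans (hL (v, false) ⟨i, hi⟩)).trans ?_
      rw [Nat.cast_le]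
      refine Finset.card_le_card fun y hy => ?_
      simp only [T, Bool.false_eq_true, if_false, Finset.mem_inter, Finset.mem_filter] at hy
      exact Finset.mem_filter.2 ⟨hy.2, hy.1.2⟩

/-- The number of parts used for the reservoir and its absorbing path. -/
def partCount (K Λ : ℕ) : ℕ :=
  Λ * (4 * Λ + 3) *
    (1 + K * (Λ * (4 * Λ + 3)) + K * (Λ * (4 * Λ + 3) * (2 * Λ + 1)))

set_option maxHeartbeats 1000000 in
/-- A pseudorandom digraph is Hamiltonian once its parameters satisfy explicit inequalities. -/
theorem IsPseudorandom.isHamiltonian_of_bounds {α p : ℝ} (hD : D.IsPseudorandom α p) (hα : 0 < α)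
    (hp : 0 < p) {l : ℝ} (hl : l = Real.log (Fintype.card V)) (hl0 : 0 < l)
    (h1 : 5 * l ^ (1.1 : ℝ) + 10 ≤ l ^ 2) (h2 : 4 * l ^ (1.1 : ℝ) + 8 ≤ 10 * l ^ (2.1 : ℝ))
    {K g Λ q m : ℕ} (hΛ : 0 < Λ) (hV : Fintype.card V < 2 ^ Λ) (hK : 2 + α < α * K)
    (hg : 1 / 2 + 3 / 2 * α ≤ α / 4 * g) (hq : q = g * partCount K Λ)
    (hm : m = Fintype.card V / q) (hqp : (4 * K * q : ℕ) ≤ α / 4 * (Fintype.card V * p))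
    (hqm : 2 * K * (4 * K * q + 1) ≤ m)
    (hmp : 10 * l ^ (2.1 : ℝ) ≤ (m / (8 * K) : ℕ) * p)
    (hprob : 2 * (Fintype.card V : ℝ) * (4 * K * q : ℕ) *
      Real.exp (-((α / 4 / (1 + 2 * α)) ^ 2 / 4) * (Fintype.card V * p / (4 * K * q : ℕ))) < 1) :
    D.IsHamiltonian := by
  set n := Fintype.card V with hn
  set x : ℝ := n * p with hx
  set ε := α / 4 / (1 + 2 * α) with hε
  set I := partCount K Λ with hI
  -- The remaining vertices are split `4 * K` times more finely. The number of covering paths is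
  -- then at most the new part size, about `m / (4 * K)` at most, plus fewer than `q'` leftovers;
  -- this fits the linking capacity `m / K` of the reservoir.
  set q' := 4 * K * q with hq'
  have hK0 : 0 < K := by
    rcases Nat.eq_zero_or_pos K with rfl | h
    · simp at hK; linarith
    · exact h
  have hg0 : 6 ≤ g := by
    have : α / 4 * 6 < α / 4 * g := by linarith
    have := lt_of_mul_lt_mul_left this (by positivity)
    exact_mod_cast this.le
  have hI0 : 0 < I := by
    rw [hI, partCount]; positivity
  have hq0 : 0 < q := by rw [hq]; positivity
  have hq'0 : 0 < q' := by positivity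
  have hqq' : q ≤ q' := by rw [hq']; exact Nat.le_mul_of_pos_left _ (by omega)
  have hm0 : 0 < m := by
    refine lt_of_lt_of_le ?_ hqm
    positivity
  have hn0 : 0 < n := by
    rcases Nat.eq_zero_or_pos n with h | h
    · rw [h] at hm; simp at hm; omega
    · exact h
  have hn0' : (0 : ℝ) < n := by exact_mod_cast hn0
  have hx0 : 0 < x := by positivity
  have hdeg : ∀ v, (1 / 2 + 2 * α) * x ≤ (D.outDegIn v Finset.univ : ℝ) ∧
      (1 / 2 + 2 * α) * x ≤ (D.inDegIn v Finset.univ : ℝ) := by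
    intro v
    have h3 := hD.semiDeg_ge v
    rw [mul_assoc] at h3
    exact ⟨h3.trans (by exact_mod_cast min_le_left _ _),
      h3.trans (by exact_mod_cast min_le_right _ _)⟩
  -- A degree is at most `n`, so (P1) itself bounds `p`.
  have hp2 : p ≤ 2 := by
    obtain ⟨v⟩ : Nonempty V := Fintype.card_pos_iff.1 hn0
    have h3 := (hdeg v).1
    have h4 : (D.outDegIn v Finset.univ : ℝ) ≤ n := by
      exact_mod_cast (Finset.card_filter_le _ _)
    have h5 : 0 < α * x := by positivity
    have h6 : n * p ≤ n * 2 := by linarith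
    exact le_of_mul_le_mul_left h6 hn0'
  have hτ0 : 0 < ⌈l ^ (1.1 : ℝ) / p⌉₊ := Nat.ceil_pos.2 (by positivity)
  have hε0 : 0 < ε := by positivity
  have hε1 : ε * (1 + 2 * α) = α / 4 := by rw [hε]; field_simp
  clear_value x ε
  have hprobq : ∀ q₀ : ℕ, 0 < q₀ → q₀ ≤ q' → ∀ b : ℝ, 1 / 2 ≤ b →
      2 * (n : ℝ) * q₀ * Real.exp (-(ε ^ 2 / 2) * (b * x / q₀)) < 1 := by
    intro q₀ h3 h4 b hb
    refine lt_of_le_of_lt ?_ hprob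
    have h5 : (q₀ : ℝ) ≤ q' := by exact_mod_cast h4
    have h3' : (0 : ℝ) < q₀ := by exact_mod_cast h3
    have h6 : x / q' ≤ x / q₀ := by gcongr
    have h7 : ε ^ 2 / 4 * (x / q') ≤ ε ^ 2 / 2 * (b * x / q₀) := by
      have h8 : 0 ≤ x / q₀ := by positivity
      have h9 : 1 / 2 * (x / q₀) ≤ b * x / q₀ := by
        rw [mul_div_assoc b x]; exact mul_le_mul_of_nonneg_right hb h8
      calc ε ^ 2 / 4 * (x / q') ≤ ε ^ 2 / 4 * (x / q₀) := by gcongr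
        _ = ε ^ 2 / 2 * (1 / 2 * (x / q₀)) := by ring
        _ ≤ _ := by gcongr
    exact mul_le_mul (by gcongr) (Real.exp_le_exp.2 (by linarith)) (Real.exp_pos _).le
      (by positivity)
  have hmq : m * q ≤ n := hm ▸ Nat.div_mul_le_self _ _
  have hmq' : n < m * q + q := by
    have h3 := Nat.div_add_mod n q
    have h4 := Nat.mod_lt n hq0
    rw [← hm] at h3
    rw [mul_comm]; omega
  -- degree into a part, relative to its size
  have hpart : ∀ (k b : ℕ) (hb : 0 < b), k * b ≤ n → (k : ℝ) * p ≤ x / b := by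
    intro k b hb hk
    have hb' : (0 : ℝ) < b := by exact_mod_cast hb
    rw [le_div_iff₀ hb', hx]
    have : (k : ℝ) * b ≤ n := by exact_mod_cast hk
    nlinarith
  obtain ⟨P, -, hPd, hPc, hPdeg⟩ := exists_good_parts D Finset.univ hq0 (c := 1 / 2 + 3 / 2 * α)
    (a := α / 4) (x := x) (ε := ε)
    (fun v => by
      have h3 := hdeg v
      rw [show 1 / 2 + 3 / 2 * α + 2 * (α / 4) = 1 / 2 + 2 * α by ring]
      exact h3)
    (le_trans (by exact_mod_cast hqq') hqp) hε0.le (by nlinarith) hx0.le (by positivity)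
    (hprobq q hq0 hqq' _ (by linarith))
  rw [Finset.card_univ, ← hn, ← hm] at hPc
  have hJd : ∀ J ⊆ Finset.range q, ∀ i ∈ J, ∀ j ∈ J, i ≠ j → Disjoint (P i) (P j) :=
    fun J hJ i hi j hj => hPd i (Finset.mem_range.1 (hJ hi)) j (Finset.mem_range.1 (hJ hj))
  have hJc : ∀ J ⊆ Finset.range q, (J.biUnion P).card = J.card * m := by
    intro J hJ
    rw [Finset.card_biUnion (hJd J hJ),
      Finset.sum_congr rfl fun i hi => hPc i (Finset.mem_range.1 (hJ hi))]
    simp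
  have hbi : ∀ X : Finset V, m / (8 * K) ≤ X.card → ∀ κ, K * κ ≤ X.card →
      (∀ v, (1 / 2 + 3 / 4 * α) * X.card * p ≤ (D.outDegIn v X : ℝ) ∧
        (1 / 2 + 3 / 4 * α) * X.card * p ≤ (D.inDegIn v X : ℝ)) →
      IsBiExpander D.Adj ⌈l ^ (1.1 : ℝ) / p⌉₊ κ X := by
    intro X hX κ hκ hXdeg
    have h3 : ((m / (8 * K) : ℕ) : ℝ) * p ≤ X.card * p := by
      gcongr
    have h4 : (0 : ℝ) < l ^ (2.1 : ℝ) := Real.rpow_pos_of_pos hl0 _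
    have h5 : (0 : ℝ) < X.card := by
      have : 0 * p < X.card * p := by linarith
      exact lt_of_mul_lt_mul_right this hp.le
    have h6 : (K : ℝ) * κ ≤ X.card := by exact_mod_cast hκ
    refine hD.isBiExpander hα hp hp2 hl hl0 h1 h2 (hmp.trans h3) ?_ hXdeg
    rcases Nat.eq_zero_or_pos κ with rfl | hκ0
    · simp; positivity
    · have h7 : (0 : ℝ) < κ := by exact_mod_cast hκ0
      nlinarith
  have hmK : m / (8 * K) ≤ m := Nat.div_le_self _ _
  obtain ⟨R, A, L, s, t, hL, hLR, hAR, hARP, habs⟩ := exists_reservoir_absorber (G := D.Adj)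
    (P := P) (q := q) (m := m) (K := K) (Λ := Λ) hΛ hτ0 hV rfl hK0 hm0 rfl
    (show I ≤ q by rw [hq]; exact Nat.le_mul_of_pos_left _ (by omega)) le_rfl le_rfl hPd hPc (by
      intro J hJ hJne κ hκ
      rw [← hJc J hJ] at hκ
      refine hbi _ ?_ κ hκ fun v => ?_
      · rw [hJc J hJ]
        exact hmK.trans (Nat.le_mul_of_pos_left _ hJne.card_pos)
      · have h3 := biUnion_degree_le (D := D) (hJd J hJ)
          (fun i hi => hPdeg i (Finset.mem_range.1 (hJ hi))) v
        have h4 := hpart m q hq0 hmq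
        have h5 : (1 / 2 + 3 / 4 * α) * (J.biUnion P).card * p ≤
            J.card * ((1 / 2 + 3 / 2 * α) * (x / q)) := by
          rw [hJc J hJ]
          push_cast
          calc (1 / 2 + 3 / 4 * α) * (J.card * m) * p
              = J.card * ((1 / 2 + 3 / 4 * α) * (m * p)) := by ring
            _ ≤ J.card * ((1 / 2 + 3 / 2 * α) * (x / q)) := by gcongr; norm_num
        exact ⟨h5.trans h3.1, h5.trans h3.2⟩)
  set W := Finset.univ \ (A ∪ R) with hW
  have hJ₁ : Finset.Ico I q ⊆ Finset.range q := fun i hi => by simp at hi ⊢; omega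
  have hUW : (Finset.Ico I q).biUnion P ⊆ W := by
    intro v hv
    rw [hW, Finset.mem_sdiff]
    refine ⟨Finset.mem_univ v, fun hvAR => ?_⟩
    obtain ⟨i, hi, hvi⟩ := Finset.mem_biUnion.1 hv
    obtain ⟨j, hj, hvj⟩ := Finset.mem_biUnion.1 (hARP hvAR)
    rw [Finset.mem_Ico] at hi
    have hj' : j < I := Finset.mem_range.1 hj
    exact Finset.disjoint_left.1 (hPd i hi.2 j (by omega) (by omega)) hvi hvj
  have hIq : I * g = q := by rw [hq, mul_comm]
  have hIq' : (I : ℝ) * g = q := by exact_mod_cast hIq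
  have hIleq : I ≤ q := by rw [hq]; exact Nat.le_mul_of_pos_left _ (by omega)
  have hq0' : (0 : ℝ) < q := by exact_mod_cast hq0
  have hWdeg : ∀ v, (1 / 2 + 3 / 4 * α + 2 * (α / 4)) * x ≤ (D.outDegIn v W : ℝ) ∧
      (1 / 2 + 3 / 4 * α + 2 * (α / 4)) * x ≤ (D.inDegIn v W : ℝ) := by
    intro v
    have h3 := biUnion_degree_le (D := D) (hJd _ hJ₁)
      (fun i hi => hPdeg i (Finset.mem_range.1 (hJ₁ hi))) v
    have h4 : (1 / 2 + 3 / 4 * α + 2 * (α / 4)) * x ≤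
        (Finset.Ico I q).card * ((1 / 2 + 3 / 2 * α) * (x / q)) := by
      rw [Nat.card_Ico, Nat.cast_sub hIleq]
      -- Only one in `g` parts is used up by reservoir and absorber, which costs at most `α / 4` in
      -- the relative degree.
      have h5 : (I : ℝ) * (1 / 2 + 3 / 2 * α) ≤ α / 4 * q := by
        rw [← hIq']
        have : (0 : ℝ) ≤ I := by positivity
        nlinarith
      have h6 : (1 / 2 + 3 / 4 * α + 2 * (α / 4)) * q ≤ (q - I) * (1 / 2 + 3 / 2 * α) := by
        linarith
      have h7 : 0 ≤ x / q := by positivity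
      calc (1 / 2 + 3 / 4 * α + 2 * (α / 4)) * x
          = (1 / 2 + 3 / 4 * α + 2 * (α / 4)) * q * (x / q) := by field_simp
        _ ≤ (q - I) * (1 / 2 + 3 / 2 * α) * (x / q) := by gcongr
        _ = _ := by ring
    exact ⟨(h4.trans h3.1).trans (by exact_mod_cast outDegIn_mono D v hUW),
      (h4.trans h3.2).trans (by exact_mod_cast inDegIn_mono D v hUW)⟩
  obtain ⟨Z, hZW, hZd, hZc, hZdeg⟩ := exists_good_parts D W hq'0 (c := 1 / 2 + 3 / 4 * α)
    (a := α / 4) (x := x) (ε := ε) hWdeg hqp hε0.le (by nlinarith) hx0.le (by positivity)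
    (hprobq q' hq'0 le_rfl _ (by linarith))
  set m' := W.card / q' with hm'
  have hWn : W.card ≤ n := Finset.card_le_univ _
  have hmq1 : m' * q' ≤ W.card := Nat.div_mul_le_self _ _
  have hmq2 : W.card < m' * q' + q' := by
    have h3 := Nat.div_add_mod W.card q'
    have h4 := Nat.mod_lt W.card hq'0
    rw [← hm'] at h3
    rw [mul_comm]; omega
  have hWc : (q - I) * m ≤ W.card := by
    have := Finset.card_le_card hUW
    rwa [hJc _ hJ₁, Nat.card_Ico] at this
  have hm'K : m / (8 * K) ≤ m' := by
    rw [hm', Nat.le_div_iff_mul_le hq'0]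
    have h3 := Nat.div_mul_le_self m (8 * K)
    have h4 : q ≤ 2 * (q - I) := by
      have : I * 6 ≤ I * g := Nat.mul_le_mul_left _ hg0
      omega
    have h5 : 2 * (m / (8 * K) * q') ≤ 2 * W.card := by
      calc 2 * (m / (8 * K) * q') = m / (8 * K) * (8 * K) * q := by rw [hq']; ring
        _ ≤ m * q := Nat.mul_le_mul_right _ h3
        _ ≤ m * (2 * (q - I)) := Nat.mul_le_mul_left _ h4
        _ = 2 * ((q - I) * m) := by ring
        _ ≤ 2 * W.card := Nat.mul_le_mul_left _ hWc
    omega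
  -- Matchings avoid no forbidden vertices, so slack `0` is enough here.
  obtain ⟨T, e, M, hT, hsum, hTc⟩ := exists_path_cover (G := D.Adj) (τ := ⌈l ^ (1.1 : ℝ) / p⌉₊)
    (κ := 0) hq'0 hZW hZd (fun j hj => (hZc j hj).trans (hZc 0 hq'0).symm) (by
      intro j hj
      refine hbi _ (by rw [hZc j hj]; exact hm'K) 0 (by simp) fun v => ?_
      have h3 := hZdeg j hj v
      have h4 := hpart m' q' hq'0 (hmq1.trans hWn)
      have h5 : (1 / 2 + 3 / 4 * α) * (Z j).card * p ≤ (1 / 2 + 3 / 4 * α) * (x / q') := by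
        rw [hZc j hj, mul_assoc]
        gcongr
      exact ⟨h5.trans h3.1, h5.trans h3.2⟩)
  rw [hZc 0 hq'0, mul_comm q'] at hTc
  have hKm' : 4 * K * m' ≤ m := by
    have h3 : 4 * K * m' * q < (m + 1) * q := by
      calc 4 * K * m' * q = m' * q' := by rw [hq']; ring
        _ ≤ n := hmq1.trans hWn
        _ < m * q + q := hmq'
        _ = (m + 1) * q := by ring
    have := Nat.lt_of_mul_lt_mul_right h3
    omega
  have hTκ : T.card + 1 ≤ m / K := by
    rw [Nat.le_div_iff_mul_le hK0]
    have h3 : T.card + 1 ≤ m' + (q' + 1) := by omega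
    have h4 : 2 * ((T.card + 1) * K) ≤ 2 * m := by
      calc 2 * ((T.card + 1) * K) ≤ 2 * ((m' + (q' + 1)) * K) := by gcongr
        _ = 2 * K * m' + 2 * K * (q' + 1) := by ring
        _ ≤ 4 * K * m' + 2 * K * (q' + 1) := by gcongr; norm_num
        _ ≤ 2 * m := by omega
    omega
  refine isHamiltonian_of_absorbing (Λ := Λ) hτ0 hV.le (by omega) hL hLR hAR habs hT hsum hTκ ?_
  calc T.card + 1 ≤ m / K := hTκ
    _ ≤ m := Nat.div_le_self _ _
    _ ≤ m * q := Nat.le_mul_of_pos_right _ hq0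
    _ ≤ n := hmq
    _ < 2 ^ Λ := hV

end Pseudorandom
-- Asymptotic comparison of the parameters.
theorem partCount_le {K Λ : ℕ} (hΛ : 0 < Λ) : partCount K Λ ≤ 7 * (1 + 28 * K) * Λ ^ 5 := by
  have h1 : Λ * (4 * Λ + 3) ≤ 7 * Λ ^ 2 := by nlinarith
  have h2 : 1 ≤ Λ ^ 3 := Nat.one_le_pow _ _ hΛ
  have h3 : Λ ^ 2 ≤ Λ ^ 3 := Nat.pow_le_pow_right hΛ (by norm_num)
  have h4 : Λ * (4 * Λ + 3) * (2 * Λ + 1) ≤ 21 * Λ ^ 3 := by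
    calc Λ * (4 * Λ + 3) * (2 * Λ + 1) ≤ 7 * Λ ^ 2 * (3 * Λ) := Nat.mul_le_mul h1 (by omega)
      _ = 21 * Λ ^ 3 := by ring
  calc partCount K Λ ≤ 7 * Λ ^ 2 * (Λ ^ 3 + K * (7 * Λ ^ 3) + K * (21 * Λ ^ 3)) := by
        refine Nat.mul_le_mul h1 (Nat.add_le_add (Nat.add_le_add h2 ?_) ?_)
        · exact Nat.mul_le_mul_left _ (by omega)
        · exact Nat.mul_le_mul_left _ h4
    _ = 7 * (1 + 28 * K) * Λ ^ 5 := by ring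

theorem natLog_two_add_one_le {n : ℕ} (hn : n ≠ 0) (hl : 3 ≤ Real.log n) :
    ((Nat.log 2 n + 1 : ℕ) : ℝ) ≤ 2 * Real.log n := by
  have h1 : 2 ^ Nat.log 2 n ≤ n := Nat.pow_log_le_self 2 hn
  have h2 : (2 : ℝ) ^ Nat.log 2 n ≤ n := by exact_mod_cast h1
  have h3 := Real.log_le_log (by positivity) h2
  rw [Real.log_pow] at h3
  have h4 := Real.log_two_gt_d9
  have h5 : (0 : ℝ) ≤ Nat.log 2 n := by positivity
  push_cast
  nlinarith

theorem eventually_rpow_log_bounds : ∀ᶠ n : ℕ in atTop,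
    5 * Real.log n ^ (1.1 : ℝ) + 10 ≤ Real.log n ^ 2 ∧
      4 * Real.log n ^ (1.1 : ℝ) + 8 ≤ 10 * Real.log n ^ (2.1 : ℝ) := by
  have hlog : Tendsto (fun n : ℕ => Real.log n) atTop atTop :=
    Real.tendsto_log_atTop.comp tendsto_natCast_atTop_atTop
  have hpow := (tendsto_rpow_atTop (show (0 : ℝ) < 0.9 by norm_num)).comp hlog
  filter_upwards [hlog.eventually_ge_atTop 2, hpow.eventually_ge_atTop 15] with n h2 h15
  simp only [Function.comp] at h15
  set l := Real.log n
  have h0 : 0 < l := by linarith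
  have h1 : 1 ≤ l ^ (1.1 : ℝ) := Real.one_le_rpow (by linarith) (by norm_num)
  have e1 : l ^ 2 = l ^ (0.9 : ℝ) * l ^ (1.1 : ℝ) := by
    rw [← Real.rpow_add h0, ← Real.rpow_natCast]; norm_num
  have e2 : l ^ (2.1 : ℝ) = l * l ^ (1.1 : ℝ) := by
    conv_rhs => rw [← Real.rpow_one_add' h0.le (by norm_num)]
    norm_num
  rw [e1, e2]
  constructor <;> nlinarith

theorem eventually_log_pow_le (C : ℝ) (k : ℕ) :
    ∀ᶠ n : ℕ in atTop, C * Real.log n ^ k ≤ n := by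
  have h := (Real.isLittleO_pow_log_id_atTop (n := k)).comp_tendsto tendsto_natCast_atTop_atTop
  have h2 := h.bound (show (0 : ℝ) < 1 / (|C| + 1) by positivity)
  filter_upwards [h2, eventually_ge_atTop 1] with n hn hn1
  simp only [Function.comp, id, Real.norm_eq_abs, Nat.abs_cast] at hn
  have h3 : C * Real.log n ^ k ≤ (|C| + 1) * |Real.log n ^ k| := by
    calc C * Real.log n ^ k ≤ |C * Real.log n ^ k| := le_abs_self _
      _ = |C| * |Real.log n ^ k| := abs_mul _ _
      _ ≤ _ := by gcongr; linarith
  refine h3.trans ?_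
  rw [div_mul_eq_mul_div, one_mul, le_div_iff₀ (by positivity)] at hn
  linarith

/-- The parameter inequalities of `IsPseudorandom.isHamiltonian_of_bounds` follow from a few
asymptotic comparisons. -/
theorem IsPseudorandom.isHamiltonian_of_le {V : Type*} [Fintype V] {D : Digraph V} {α p : ℝ}
    (hD : D.IsPseudorandom α p) (hα : 0 < α) {l : ℝ} (hl : l = Real.log (Fintype.card V))
    (hl3 : 3 ≤ l) (h1 : 5 * l ^ (1.1 : ℝ) + 10 ≤ l ^ 2)
    (h2 : 4 * l ^ (1.1 : ℝ) + 8 ≤ 10 * l ^ (2.1 : ℝ)) {K g : ℕ} (hK : 2 + α < α * K)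
    (hg : 1 / 2 + 3 / 2 * α ≤ α / 4 * g) {C B : ℝ} (hC : C = 7 * (1 + 28 * K) * 32 * g)
    (hn : 2 * K * (4 * K * C + 1) * C * l ^ 10 ≤ Fintype.card V)
    (hnp : B * l ^ 8 ≤ Fintype.card V * p) (hB1 : 4 * K * C ≤ α / 4 * B)
    (hB2 : 160 * K * C ≤ B)
    (hB3 : 3 * (4 * K * C) ≤ (α / 4 / (1 + 2 * α)) ^ 2 / 4 * B) : D.IsHamiltonian := by
  set n := Fintype.card V with hndef
  have hK0 : 0 < K := by
    rcases Nat.eq_zero_or_pos K with rfl | h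
    · simp at hK; linarith
    · exact h
  have hg0 : 0 < g := by
    rcases Nat.eq_zero_or_pos g with rfl | h
    · simp at hg; linarith
    · exact h
  have hK0' : (1 : ℝ) ≤ K := by exact_mod_cast hK0
  have hg0' : (1 : ℝ) ≤ g := by exact_mod_cast hg0
  have hn0 : n ≠ 0 := by
    rintro h
    rw [h] at hl; simp at hl; linarith
  have hn0' : (0 : ℝ) < n := by exact_mod_cast Nat.pos_of_ne_zero hn0
  have hC0 : 0 < C := by rw [hC]; positivity
  have hB0 : 0 < B := by
    refine lt_of_lt_of_le ?_ hB2
    positivity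
  have hl0 : 0 < l := by linarith
  have hp : 0 < p := by
    have : n * 0 < n * p := by
      rw [mul_zero]; refine lt_of_lt_of_le ?_ hnp; positivity
    exact lt_of_mul_lt_mul_left this hn0'.le
  set Λ := Nat.log 2 n + 1 with hΛ
  have hΛ0 : 0 < Λ := by omega
  have hΛl : (Λ : ℝ) ≤ 2 * l := by rw [hl]; exact natLog_two_add_one_le hn0 (hl ▸ hl3)
  set q := g * partCount K Λ with hq
  have hq0 : 0 < q := by rw [hq, partCount]; positivity
  have hq0' : (0 : ℝ) < q := by exact_mod_cast hq0
  have hqC : (q : ℝ) ≤ C * l ^ 5 := by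
    have h3 : (partCount K Λ : ℝ) ≤ 7 * (1 + 28 * K) * (Λ : ℝ) ^ 5 := by
      exact_mod_cast partCount_le hΛ0
    calc (q : ℝ) = g * partCount K Λ := by rw [hq]; push_cast; ring
      _ ≤ g * (7 * (1 + 28 * K) * (2 * l) ^ 5) := by
          refine mul_le_mul_of_nonneg_left (h3.trans ?_) (by positivity)
          gcongr
      _ = C * l ^ 5 := by rw [hC]; ring
  have hq'C : ((4 * K * q : ℕ) : ℝ) ≤ 4 * K * C * l ^ 5 := by
    push_cast
    calc (4 * K * q : ℝ) ≤ 4 * K * (C * l ^ 5) := by gcongr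
      _ = _ := by ring
  have hl1 : 1 ≤ l := by linarith
  have hqm : 2 * K * (4 * K * q + 1) ≤ n / q := by
    rw [Nat.le_div_iff_mul_le hq0]
    have h3 : (2 * K * (4 * K * q + 1) * q : ℝ) ≤ n := by
      refine le_trans ?_ hn
      have h4 : (4 * K * q + 1 : ℝ) ≤ (4 * K * C + 1) * l ^ 5 := by
        push_cast at hq'C
        nlinarith [one_le_pow₀ hl1 (n := 5)]
      calc (2 * K * (4 * K * q + 1) * q : ℝ) ≤ 2 * K * ((4 * K * C + 1) * l ^ 5) * (C * l ^ 5) := by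
            gcongr
        _ = _ := by ring
    exact_mod_cast h3
  have hqn : 8 * K * q ≤ n := by
    calc 8 * K * q ≤ 8 * (K * K) * q := by gcongr; exact Nat.le_mul_of_pos_left _ hK0
      _ ≤ 2 * K * (4 * K * q + 1) * 1 := by linarith
      _ ≤ n / q * q := Nat.mul_le_mul hqm hq0
      _ ≤ n := Nat.div_mul_le_self _ _
  have hl85 : l ^ 8 = l ^ 3 * l ^ 5 := by ring
  have hl3' : l ≤ l ^ 3 := le_self_pow₀ hl1 (by norm_num)
  refine hD.isHamiltonian_of_bounds hα hp hl hl0 h1 h2 hΛ0 (Nat.lt_pow_succ_log_self (by norm_num) n)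
    hK hg hq rfl ?_ hqm ?_ ?_
  · calc ((4 * K * q : ℕ) : ℝ) ≤ 4 * K * C * l ^ 5 := hq'C
      _ ≤ α / 4 * B * l ^ 8 := by
          gcongr
          norm_num
      _ ≤ α / 4 * (n * p) := by rw [mul_assoc]; gcongr
  · have h3 : (n : ℝ) ≤ 16 * K * q * (n / q / (8 * K) : ℕ) := by
      rw [Nat.div_div_eq_div_mul]
      have h4 := Nat.lt_mul_div_succ n (show 0 < q * (8 * K) by positivity)
      have h5 : 1 ≤ n / (q * (8 * K)) :=
        (Nat.one_le_div_iff (by positivity)).2 (by linarith)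
      have h6 : n ≤ 16 * K * q * (n / (q * (8 * K))) := by nlinarith
      exact_mod_cast h6
    have h4 : 10 * l ^ (2.1 : ℝ) * (16 * K * q) ≤ (n / q / (8 * K) : ℕ) * p * (16 * K * q) := by
      -- The origin of the exponent 8 in this argument: there are of order `l ^ 5` parts, and each
      -- needs size times `p` at least of order `l ^ 2.1`, here rounded up to `l ^ 3`.
      have h5 : l ^ (2.1 : ℝ) ≤ l ^ 3 := by
        rw [← Real.rpow_natCast]
        exact Real.rpow_le_rpow_of_exponent_le hl1 (by norm_num)
      calc 10 * l ^ (2.1 : ℝ) * (16 * K * q) ≤ 10 * l ^ 3 * (16 * K * (C * l ^ 5)) := by gcongr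
        _ = 160 * K * C * l ^ 8 := by ring
        _ ≤ B * l ^ 8 := by gcongr
        _ ≤ n * p := hnp
        _ ≤ 16 * K * q * (n / q / (8 * K) : ℕ) * p := by gcongr
        _ = _ := by ring
    exact le_of_mul_le_mul_right h4 (by positivity)
  · set E := (α / 4 / (1 + 2 * α)) ^ 2 / 4 with hE
    have hE0 : 0 < E := by positivity
    have hq'0 : (0 : ℝ) < (4 * K * q : ℕ) := by
      have : 0 < 4 * K * q := by positivity
      exact_mod_cast this
    -- An exponent of `3 * l` bounds the exponential by `n⁻³`, against a union-bound factor of at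
    -- most `n ^ 2`.
    have h3 : 3 * l ≤ E * (n * p / (4 * K * q : ℕ)) := by
      rw [← mul_div_assoc, le_div_iff₀ hq'0]
      calc 3 * l * (4 * K * q : ℕ) ≤ 3 * l ^ 3 * (4 * K * C * l ^ 5) := by gcongr
        _ = 3 * (4 * K * C) * l ^ 8 := by ring
        _ ≤ E * B * l ^ 8 := by gcongr
        _ ≤ E * (n * p) := by rw [mul_assoc]; gcongr
    have h4 : Real.exp (-E * (n * p / (4 * K * q : ℕ))) ≤ 1 / (n : ℝ) ^ 3 := by
      calc Real.exp (-E * (n * p / (4 * K * q : ℕ))) ≤ Real.exp (-(3 * l)) := by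
            rw [Real.exp_le_exp]; linarith
        _ = 1 / (n : ℝ) ^ 3 := by
            rw [Real.exp_neg, ← Real.exp_log hn0', ← hl, ← Real.exp_nat_mul]
            simp
    have h5 : (2 * (4 * K * q : ℕ) : ℝ) ≤ n := by
      have : 2 * (4 * K * q) ≤ n := by linarith
      exact_mod_cast this
    have h6 : (1 : ℝ) < n := by
      have := Real.log_le_sub_one_of_pos hn0'
      linarith
    calc 2 * (n : ℝ) * (4 * K * q : ℕ) * Real.exp (-E * (n * p / (4 * K * q : ℕ)))
        ≤ 2 * (n : ℝ) * (4 * K * q : ℕ) * (1 / (n : ℝ) ^ 3) := by gcongr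
      _ = n * (2 * (4 * K * q : ℕ)) * (1 / (n : ℝ) ^ 3) := by ring
      _ ≤ n * n * (1 / (n : ℝ) ^ 3) := by gcongr
      _ = 1 / n := by field_simp
      _ < 1 := by rw [div_lt_one hn0']; exact h6

end Digraph

theorem mainTheorem2 (α : ℝ) (hα : 0 < α) (p : ℕ → ℝ)
    (hp : Tendsto (fun n : ℕ => p n / (Real.log n ^ 8 / n)) atTop atTop) :
    ∀ᶠ n : ℕ in atTop, ∀ (V : Type*) [Fintype V] (D : Digraph V),
      Fintype.card V = n → D.IsPseudorandom α (p n) → D.IsHamiltonian := by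
  obtain ⟨K, hK⟩ := exists_nat_gt ((2 + α) / α)
  obtain ⟨g, hg⟩ := exists_nat_gt ((1 / 2 + 3 / 2 * α) / (α / 4))
  rw [div_lt_iff₀ hα, mul_comm] at hK
  rw [div_lt_iff₀ (by positivity), mul_comm] at hg
  set C : ℝ := 7 * (1 + 28 * K) * 32 * g with hC
  have hC0 : 0 ≤ C := by positivity
  set E := (α / 4 / (1 + 2 * α)) ^ 2 / 4 with hE
  have hE0 : 0 < E := by positivity
  -- One summand for each of the three lower bounds required of `B`.
  set B : ℝ := 4 * K * C / (α / 4) + 160 * K * C + 3 * (4 * K * C) / E with hB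
  have hlog : Tendsto (fun n : ℕ => Real.log n) atTop atTop :=
    Real.tendsto_log_atTop.comp tendsto_natCast_atTop_atTop
  have hb1 : 0 ≤ 4 * K * C / (α / 4) := by positivity
  have hb2 : 0 ≤ 160 * K * C := by positivity
  have hb3 : 0 ≤ 3 * (4 * K * C) / E := by positivity
  filter_upwards [hlog.eventually_ge_atTop 3, Digraph.eventually_rpow_log_bounds,
    Digraph.eventually_log_pow_le (2 * K * (4 * K * C + 1) * C) 10, hp.eventually_ge_atTop B,
    eventually_gt_atTop 0] with n hl3 hl hn hnp hn0 V _ D hV hD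
  subst hV
  have hn0' : (0 : ℝ) < Fintype.card V := by exact_mod_cast hn0
  refine hD.isHamiltonian_of_le hα rfl hl3 hl.1 hl.2 hK (by linarith) hC hn (B := B) ?_ ?_ ?_ ?_
  · rw [le_div_iff₀ (by positivity), mul_div_assoc', div_le_iff₀ hn0'] at hnp
    linarith
  · calc 4 * K * C = α / 4 * (4 * K * C / (α / 4)) := by field_simp
      _ ≤ α / 4 * B := by gcongr; linarith
  · linarith
  · calc 3 * (4 * K * C) = E * (3 * (4 * K * C) / E) := by field_simp
      _ ≤ E * B := by gcongr; linarith
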